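/- Let $\mathrm{S}_5$ act transitively on a set $X$ with $6$ elements (for instance by conjugation on its six subgroups of order $5$). Let $H=\{\pm1\}^X\rtimes \mathrm{S}_5$, where $\mathrm{S}_5$ permutes the coordinates, let $\pi:H\to \mathrm{S}_5$ be the projection, and let $\delta:\{\pm1\}\to\{\pm1\}^X\subset H$ be the diagonal embedding, whose image, again written $\{\pm1\}$, is central in $H$. Let $\mathcal{G}$ be the set of subgroups $K\subset H$ with $\pi(K)=\mathrm{S}_5$ and $\ker\pi\cap K=\delta(\{\pm1\})$; each such $K$ is a central extension $1\to\{\pm1\}\xrightarrow{\delta}K\xrightarrow{\pi}\mathrm{S}_5\to1$. Then $\mathcal{G}$ is the disjoint union of exactly two $H$-conjugacy classes. One is the class of the subgroup $\{\pm1\}\cdot \mathrm{S}_5$, and it consists of split extensions. The other consists of extensions which do not split over $\mathrm{S}_5$ but split over the alternating subgroup $\mathrm{Alt}_5$. The second class is realized by $\mathrm{GL}_2(\mathbb{Z}/5)/\{\pm \mathrm{I}_2\}$ as follows. The group $\mathrm{GL}_2(\mathbb{Z}/5)$ acts on the $12$-element set $((\mathbb{Z}/5)^2\setminus\{0\})/\{\pm1\}$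 and permutes its $6$ pairs $\{\pm v,\pm 2v\}$. Call a homomorphism $\iota:\mathrm{GL}_2(\mathbb{Z}/5)/\{\pm \mathrm{I}_2\}\to H$ natural if there are vectors $v_x\in(\mathbb{Z}/5)^2\setminus\{0\}$ $(x\in X)$ such that $((\mathbb{Z}/5)^2\setminus\{0\})/\{\pm1\}$ is the disjoint union of the six two-element sets $\{\pm v_x,\pm 2v_x\}$ and such that, for all $g$ and $x$, writing $\iota(g)=(f,\sigma)$ with $f\in\{\pm1\}^X$ and $\sigma\in \mathrm{S}_5$, one has $g v_x=\pm v_{\sigma x}$ if $f(\sigma x)=1$ and $g v_x=\pm 2v_{\sigma x}$ if $f(\sigma x)=-1$. Natural homomorphisms exist, and each of them is injective with image in the second class. -/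

import Mathlib

open Equiv

/-- The semidirect product `A^X ⋊ G` attached to an action of `G` on `X`, where `G` acts on
functions by `(g • f) x = f (g⁻¹ • x)`. -/
abbrev WreathSemi (G X A : Type*) [Group G] [MulAction G X] [CommGroup A] : Type _ :=
  (X → A) ⋊[(mulAutArrow : G →* MulAut (X → A))] G

namespace WreathSemi

section General

variable (G X A : Type*) [Group G] [MulAction G X] [CommGroup A]

/-- The projection `π : A^X ⋊ G → G`. -/
def proj : WreathSemi G X A →* G := SemidirectProduct.rightHom

/-- The diagonal map `δ : A → A^X ⊂ A^X ⋊ G`. -/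
def diag : A →* WreathSemi G X A :=
  (SemidirectProduct.inl : (X → A) →* WreathSemi G X A).comp (Pi.constMonoidHom X A)

/-- The set `𝒢` of subgroups `K` of `A^X ⋊ G` with `π(K) = G` and `ker π ∩ K = δ(A)`, that is,
those for which `1 → A → K → G → 1` (with the maps `δ` and `π`) is exact. -/
def extensions : Set (Subgroup (WreathSemi G X A)) :=
  {K | K.map (proj G X A) = ⊤ ∧ (proj G X A).ker ⊓ K = (diag G X A).range}

/-- The image of `δ` is central, so the extensions in `𝒢` are central. -/
theorem diag_range_le_center :
    (diag G X A).range ≤ Subgroup.center (WreathSemi G X A) := by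
  rintro _ ⟨a, rfl⟩
  rw [Subgroup.mem_center_iff]
  intro h
  ext x
  · have e : (diag G X A a * h).left x = a * h.left x := by simp [diag]
    rw [e]
    exact mul_comm (h.left x) a
  · simp [diag]

/-- The subgroup `δ(A) · G` of `A^X ⋊ G`. -/
def splitExt : Subgroup (WreathSemi G X A) :=
  (diag G X A).range ⊔ (SemidirectProduct.inr : G →* WreathSemi G X A).range

end General

section

variable {G X A : Type*} [Group G] [MulAction G X] [CommGroup A]

/-- The extension `π : K → G` splits over the subgroup `G'` of `G`: there is a homomorphic section
`G' → K` of `π`. -/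
def SplitsOver (K : Subgroup (WreathSemi G X A)) (G' : Subgroup G) : Prop :=
  ∃ s : G' →* K, ∀ g : G', proj G X A (s g) = g

end

end WreathSemi

/-- The set of the conjugates of the subgroup `K` of `H`. -/
def subgroupConjClass {H : Type*} [Group H] (K : Subgroup H) : Set (Subgroup H) :=
  {K' | ∃ h : H, K' = K.map (MulAut.conj h).toMonoidHom}

/-- The subgroup `{± I₂}` of `GL₂(ℤ/5)`. -/
def pmOne : Subgroup (Matrix.GeneralLinearGroup (Fin 2) (ZMod 5)) := Subgroup.zpowers (-1)

instance pmOne_normal : pmOne.Normal := by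
  constructor
  intro n hn g
  have hc : pmOne ≤ Subgroup.center (Matrix.GeneralLinearGroup (Fin 2) (ZMod 5)) := by
    rw [pmOne, Subgroup.zpowers_le, Subgroup.mem_center_iff]
    intro g
    simp
  have h := Subgroup.mem_center_iff.mp (hc hn) g
  rw [h, mul_inv_cancel_right]
  exact hn

/-- The group `GL₂(ℤ/5) / {± I₂}`. -/
abbrev GLModPm : Type := Matrix.GeneralLinearGroup (Fin 2) (ZMod 5) ⧸ pmOne

/-- The element `1` or `2` of `ℤ/5` according to whether the sign is `1` or `-1`; modulo `±1` this
is the isomorphism `{±1} ≃ (ℤ/5)ˣ / {±1}`. -/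
def signScalar (a : ℤˣ) : ZMod 5 := if a = 1 then 1 else 2

/-- `v` is a choice of vectors such that `((ℤ/5)² - {0}) / {±1}` is the disjoint union of the pairs
`{v x, 2 v x}`, for `x` in `X`: each nonzero vector is, for a unique sign `a` and a unique `x`,
equal up to sign to `v x` (if `a = 1`) or `2 v x` (if `a = -1`). -/
def IsPairSystem {X : Type*} (v : X → (Fin 2 → ZMod 5)) : Prop :=
  (∀ x, v x ≠ 0) ∧
    ∀ w : Fin 2 → ZMod 5, w ≠ 0 →
      ∃! p : ℤˣ × X, w = signScalar p.1 • v p.2 ∨ w = -(signScalar p.1 • v p.2)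

/-- `ι : GL₂(ℤ/5) / {± I₂} → {±1}^X ⋊ S₅` is one of the natural homomorphisms given by the action of
`GL₂(ℤ/5)` on `((ℤ/5)² - {0}) / {±1}`, which permutes the pairs `{v, 2v}`: for some choice of
vectors `v x` as above, if `ι(g) = (f, σ)` then `g (v x)` is, up to sign, `v (σ x)` if
`f (σ x) = 1`, and `2 v (σ x)` if `f (σ x) = -1`. -/
def IsNaturalHom {X : Type*} [MulAction (Perm (Fin 5)) X]
    (ι : GLModPm →* WreathSemi (Perm (Fin 5)) X ℤˣ) : Prop :=
  ∃ v : X → (Fin 2 → ZMod 5), IsPairSystem v ∧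
    ∀ (g : Matrix.GeneralLinearGroup (Fin 2) (ZMod 5)) (x : X),
      let h := ι (QuotientGroup.mk g)
      let y := h.right • x
      (g : Matrix (Fin 2) (Fin 2) (ZMod 5)).mulVec (v x) = signScalar (h.left y) • v y ∨
        (g : Matrix (Fin 2) (Fin 2) (ZMod 5)).mulVec (v x) = -(signScalar (h.left y) • v y)

/-! In suitable coordinates the six points form the projective line `ℤ/5 ∪ {∞}`, and `S₅` is
generated by `z ↦ z + 1`, `z ↦ 2 z` and `z ↦ 1 / z` (`exists_line_coordinates`). An extension in `𝒢`
is determined by lifts of these generators. Relations among the generators hold for the lifts up to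
a global sign; comparing values at different points of the line shows that, after conjugation by
functions `X → {±1}`, the lifts depend on a single sign `ε` (`exists_conj_isNormalForm`). Hence
there are at most two classes, and `ε = 1` gives `{±1} · S₅`.

The other class is seen on matrices. A matrix determines its action on the pairs
(`PairAction.unique`), only scalars fix every pair, and a scalar `c` acts as the diagonal sign `c ^
2`; counting then puts the image of a natural homomorphism in `𝒢`. In a splitting over `S₅`, a
transposition would lift to `r` with `r ^ 2 = ±1`, so `det r ^ 2 = 1`. Since `det ^ 2` is unchanged
by scalars (`c ^ 4 = 1`), it would be `1` everywhere, yet it is `-1` on `diag(2, 1)`. In fact `det ^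
2` is the sign of the permutation (`exists_pairAction_sign`), so over `Alt₅` the matrices of
determinant `1` provide a section. -/

namespace WreathSemi

/-! ### Extensions inside a wreath product. -/

section Generic

variable {G X A : Type*} [Group G] [MulAction G X] [CommGroup A]

theorem mul_left_apply (a b : WreathSemi G X A) (x : X) :
    (a * b).left x = a.left x * b.left (a.right⁻¹ • x) := rfl

@[simp]
theorem proj_apply (a : WreathSemi G X A) : proj G X A a = a.right := rfl

@[simp]
theorem diag_left (a : A) (x : X) : (diag G X A a).left x = a := rfl

@[simp]
theorem diag_right (a : A) : (diag G X A a).right = 1 := rfl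

theorem inl_conj_left (m : X → A) (a : WreathSemi G X A) (x : X) :
    ((SemidirectProduct.inl m : WreathSemi G X A) * a * (SemidirectProduct.inl m)⁻¹).left x =
      m x * a.left x * (m (a.right⁻¹ • x))⁻¹ := by
  rw [← map_inv, mul_left_apply, mul_left_apply]
  simp

theorem inl_conj_right (m : X → A) (a : WreathSemi G X A) :
    ((SemidirectProduct.inl m : WreathSemi G X A) * a * (SemidirectProduct.inl m)⁻¹).right =
      a.right := by
  simp

variable {K K' : Subgroup (WreathSemi G X A)}

theorem diag_mem (hK : K ∈ extensions G X A) (a : A) : diag G X A a ∈ K :=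
  (hK.2.ge ⟨a, rfl⟩ : diag G X A a ∈ (proj G X A).ker ⊓ K).2

theorem exists_mem_right (hK : K ∈ extensions G X A) (σ : G) :
    ∃ f : X → A, (⟨f, σ⟩ : WreathSemi G X A) ∈ K := by
  have h : σ ∈ K.map (proj G X A) := hK.1 ▸ Subgroup.mem_top σ
  obtain ⟨a, ha, rfl⟩ := h
  exact ⟨a.left, ha⟩

theorem left_const (hK : K ∈ extensions G X A) {a : WreathSemi G X A} (ha : a ∈ K)
    (h1 : a.right = 1) : ∃ s : A, ∀ x, a.left x = s := by
  obtain ⟨s, rfl⟩ := (hK.2.le ⟨h1, ha⟩ : a ∈ (diag G X A).range)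
  exact ⟨s, fun _ => rfl⟩

theorem left_eq_const_mul (hK : K ∈ extensions G X A) {a b : WreathSemi G X A} (ha : a ∈ K)
    (hb : b ∈ K) (h : a.right = b.right) : ∃ s : A, ∀ x, a.left x = s * b.left x := by
  obtain ⟨s, hs⟩ := left_const hK (K.mul_mem ha (K.inv_mem hb)) (by simp [h])
  refine ⟨s, fun x => ?_⟩
  have e : a = a * b⁻¹ * b := by group
  have h1 : (a * b⁻¹).right = 1 := by simp [h]
  rw [e, mul_left_apply, hs, h1]
  simp

theorem const_mul_mem (hK : K ∈ extensions G X A) {f g : X → A} {σ : G} (s : A)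
    (hg : (⟨g, σ⟩ : WreathSemi G X A) ∈ K) (h : ∀ x, f x = s * g x) :
    (⟨f, σ⟩ : WreathSemi G X A) ∈ K := by
  have e : (⟨f, σ⟩ : WreathSemi G X A) = diag G X A s * ⟨g, σ⟩ := by
    ext x
    · simp [mul_left_apply, h]
    · simp
  rw [e]
  exact K.mul_mem (diag_mem hK s) hg

/-- Two lifts in `K` of one element of `G` differ by an element of `δ(A)`, which `K'` contains too.
It is therefore enough that the two extensions share lifts of generators of `G`. -/
theorem le_of_map_inf_eq_top (hK : K ∈ extensions G X A) (hK' : K' ∈ extensions G X A)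
    (h : (K ⊓ K').map (proj G X A) = ⊤) : K ≤ K' := by
  intro k hk
  obtain ⟨l, hl, hlk⟩ : proj G X A k ∈ (K ⊓ K').map (proj G X A) := h ▸ Subgroup.mem_top _
  obtain ⟨s, hs⟩ : k * l⁻¹ ∈ (diag G X A).range :=
    hK.2.le ⟨MonoidHom.mem_ker.mpr (by rw [map_mul, map_inv, hlk, mul_inv_cancel]),
      K.mul_mem hk (K.inv_mem hl.1)⟩
  have e : k = diag G X A s * l := by rw [hs]; group
  rw [e]
  exact K'.mul_mem (diag_mem hK' s) hl.2

theorem eq_of_map_inf_eq_top (hK : K ∈ extensions G X A) (hK' : K' ∈ extensions G X A)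
    (h : (K ⊓ K').map (proj G X A) = ⊤) : K = K' :=
  le_antisymm (le_of_map_inf_eq_top hK hK' h) (le_of_map_inf_eq_top hK' hK (inf_comm K K' ▸ h))

theorem conj_mem_extensions (h : WreathSemi G X A) (hK : K ∈ extensions G X A) :
    K.map (MulAut.conj h).toMonoidHom ∈ extensions G X A := by
  refine ⟨top_le_iff.mp fun σ _ => ?_, le_antisymm ?_ ?_⟩
  · obtain ⟨f, hf⟩ := exists_mem_right hK (h.right⁻¹ * σ * h.right)
    refine ⟨_, ⟨_, hf, rfl⟩, ?_⟩
    simp [mul_assoc]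
  · rintro _ ⟨h1, k, hk, rfl⟩
    have hk1 : k ∈ (proj G X A).ker := by
      have h2 : h.right * k.right * h.right⁻¹ = 1 := h1
      have : k.right = 1 := by simpa using h2
      exact this
    obtain ⟨s, rfl⟩ := hK.2.le ⟨hk1, hk⟩
    refine ⟨s, ?_⟩
    have := Subgroup.mem_center_iff.mp (diag_range_le_center G X A ⟨s, rfl⟩) h
    change _ = h * diag G X A s * h⁻¹
    rw [this, mul_inv_cancel_right]
  · rintro _ ⟨s, rfl⟩
    refine ⟨by simp, diag G X A s, diag_mem hK s, ?_⟩
    have := Subgroup.mem_center_iff.mp (diag_range_le_center G X A ⟨s, rfl⟩) h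
    change h * diag G X A s * h⁻¹ = _
    rw [this, mul_inv_cancel_right]

theorem inr_mem_splitExt (σ : G) :
    (SemidirectProduct.inr σ : WreathSemi G X A) ∈ splitExt G X A :=
  Subgroup.mem_sup_right ⟨σ, rfl⟩

theorem splitExt_mem_extensions : splitExt G X A ∈ extensions G X A := by
  refine ⟨top_le_iff.mp fun σ _ => ⟨_, inr_mem_splitExt σ, rfl⟩, le_antisymm ?_ ?_⟩
  · rintro k ⟨h1, hk⟩
    have : (diag G X A).range.Normal :=
      ⟨fun n hn g => by
        rw [Subgroup.mem_center_iff.mp (diag_range_le_center G X A hn) g, mul_inv_cancel_right]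
        exact hn⟩
    obtain ⟨_, ⟨s, rfl⟩, _, ⟨σ, rfl⟩, rfl⟩ := Subgroup.mem_sup_of_normal_left.mp hk
    have h2 : σ = 1 := by
      have : (diag G X A s * SemidirectProduct.inr σ).right = 1 := h1
      simpa using this
    exact ⟨s, by simp [h2]⟩
  · rintro _ ⟨s, rfl⟩
    exact ⟨by simp, Subgroup.mem_sup_left ⟨s, rfl⟩⟩

theorem splitExt_splitsOver_top : SplitsOver (splitExt G X A) ⊤ :=
  ⟨(SemidirectProduct.inr.comp (⊤ : Subgroup G).subtype).codRestrict _
    fun g => inr_mem_splitExt (g : G), fun _ => rfl⟩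

/-- Conjugation by `h` also conjugates the base by `π(h)`; precomposing the section with the inverse
conjugation of `N` compensates, which is where normality enters. -/
theorem SplitsOver.conj {N : Subgroup G} [hN : N.Normal] (hs : SplitsOver K N)
    (h : WreathSemi G X A) : SplitsOver (K.map (MulAut.conj h).toMonoidHom) N := by
  obtain ⟨s, hs⟩ := hs
  refine ⟨((K.equivMapOfInjective (MulAut.conj h).toMonoidHom
    (MulAut.conj h).injective).toMonoidHom.comp s).comp
      (MulAut.conjNormal (H := N) h.right⁻¹).toMonoidHom, fun g => ?_⟩
  have e := hs (MulAut.conjNormal (H := N) h.right⁻¹ g)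
  simp only [proj_apply, MulAut.conjNormal_apply] at e
  change (h * (s (MulAut.conjNormal (H := N) h.right⁻¹ g) : WreathSemi G X A) * h⁻¹).right = g
  rw [SemidirectProduct.mul_right, SemidirectProduct.mul_right, e]
  simp [mul_assoc]

end Generic

end WreathSemi

/-! ### Conjugacy of subgroups as an equivalence relation. -/

section ConjClass

variable {H : Type*} [Group H] {K K' K'' : Subgroup H}

theorem mem_subgroupConjClass_symm (h : K' ∈ subgroupConjClass K) : K ∈ subgroupConjClass K' := by
  obtain ⟨a, rfl⟩ := h
  refine ⟨a⁻¹, ?_⟩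
  ext k
  simp [Subgroup.mem_map, mul_assoc]

theorem mem_subgroupConjClass_trans (h : K' ∈ subgroupConjClass K)
    (h' : K'' ∈ subgroupConjClass K') : K'' ∈ subgroupConjClass K := by
  obtain ⟨a, rfl⟩ := h
  obtain ⟨b, rfl⟩ := h'
  refine ⟨b * a, ?_⟩
  ext k
  simp [Subgroup.mem_map, mul_assoc]

end ConjClass

/-- The permutation `i ↦ 2 i` of `ℤ/5`. -/
def doublePerm : Perm (Fin 5) where
  toFun i := 2 * i
  invFun i := 3 * i
  left_inv := by decide
  right_inv := by decide

theorem closure_finRotate_swap : Subgroup.closure {finRotate 5, swap (1 : Fin 5) 4} = ⊤ :=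
  Equiv.Perm.closure_prime_cycle_swap (by simp [Nat.prime_five]) (isCycle_finRotate)
    support_finRotate ⟨1, 4, by decide, rfl⟩

/-- The translation `z ↦ 1 + z` of the projective line `ℤ/5 ∪ {∞}`. -/
def lineShift : Option (ZMod 5) → Option (ZMod 5) := Option.map (1 + ·)

/-- The homothety `z ↦ 2 z` of the projective line `ℤ/5 ∪ {∞}`. -/
def lineDouble : Option (ZMod 5) → Option (ZMod 5) := Option.map (2 * ·)

/-- The inversion `z ↦ 1 / z = z ^ 3` of the projective line `ℤ/5 ∪ {∞}`. -/
def lineInv : Option (ZMod 5) → Option (ZMod 5)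
  | none => some 0
  | some z => if z = 0 then none else some (z ^ 3)

/-! ### The six points as the projective line over `ℤ/5`. -/

section Coordinates

variable {X : Type*} [MulAction (Perm (Fin 5)) X]

theorem finRotate_pow_add_smul (k l : ZMod 5) (x : X) :
    finRotate 5 ^ (k + l).val • x = finRotate 5 ^ k.val • finRotate 5 ^ l.val • x := by
  rw [smul_smul]
  congr 1
  revert k l
  decide

theorem doublePerm_finRotate_pow_smul (k : ZMod 5) (x : X) :
    doublePerm • finRotate 5 ^ k.val • x = finRotate 5 ^ (2 * k).val • doublePerm • x := by
  rw [smul_smul, smul_smul]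
  congr 1
  revert k
  decide

theorem doublePerm_swap_doublePerm_smul (x : X) :
    doublePerm • swap (1 : Fin 5) 4 • doublePerm • x = swap (1 : Fin 5) 4 • x := by
  rw [smul_smul, smul_smul]
  congr 1
  decide

theorem swap_swap_smul (x : X) : swap (1 : Fin 5) 4 • swap (1 : Fin 5) 4 • x = x := by
  rw [smul_smul, swap_mul_self, one_smul]

set_option maxRecDepth 4000 in
theorem finRotate_smul_eq_of_pow {k : ZMod 5} (hk : k ≠ 0) {x : X}
    (h : finRotate 5 ^ k.val • x = x) : finRotate 5 • x = x := by
  have h1 : finRotate 5 ∈ Subgroup.zpowers (finRotate 5 ^ k.val) := by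
    have : ∀ k : ZMod 5, k ≠ 0 → ∃ n : Fin 5, (finRotate 5 ^ k.val) ^ (n : ℕ) = finRotate 5 := by
      decide
    obtain ⟨n, hn⟩ := this k hk
    exact ⟨n, by simpa using hn⟩
  have h2 : Subgroup.zpowers (finRotate 5 ^ k.val) ≤ MulAction.stabilizer _ x := by
    rw [Subgroup.zpowers_le]; exact h
  exact h2 h1

/-- In a finite group the two generators generate already as a monoid, so stability under inverses
need not be assumed. -/
theorem mem_of_isPretransitive [MulAction.IsPretransitive (Perm (Fin 5)) X] {S : Set X} {x : X}
    (hx : x ∈ S) (hc : ∀ y ∈ S, finRotate 5 • y ∈ S)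
    (ht : ∀ y ∈ S, swap (1 : Fin 5) 4 • y ∈ S) (y : X) : y ∈ S := by
  obtain ⟨g, rfl⟩ := MulAction.exists_smul_eq (Perm (Fin 5)) x y
  have hg : g ∈ Submonoid.closure {finRotate 5, swap (1 : Fin 5) 4} := by
    have h := congrArg Subgroup.toSubmonoid closure_finRotate_swap
    rw [Subgroup.closure_toSubmonoid_of_finite] at h
    rw [h]; trivial
  induction hg using Submonoid.closure_induction_left with
  | one => simpa using hx
  | mul_left a ha b _ ih =>
    rw [mul_smul]
    rcases ha with rfl | rfl
    · exact hc _ ih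
    · exact ht _ ih

/-- The number of fixed points of an element of order 5 is congruent to 6 modulo 5, so it is 1 or 6.
If it were 6, the set `{x, swap 1 4 • x}` would be stable under both generators, contradicting
transitivity on six points. -/
theorem exists_unique_finRotate_fixed [MulAction.IsPretransitive (Perm (Fin 5)) X]
    (hX : Nat.card X = 6) :
    ∃ p : X, finRotate 5 • p = p ∧ ∀ q : X, finRotate 5 • q = q → q = p := by
  classical
  have : Finite X := Nat.finite_of_card_ne_zero (by omega)
  have := Fintype.ofFinite X
  have hF : Fintype.card X = 6 := by rw [← Nat.card_eq_fintype_card, hX]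
  let f : Function.End X := fun x => finRotate 5 • x
  have hf : f ^ 5 ^ 1 = 1 := by
    have h5 : finRotate 5 ^ 5 = 1 := by decide
    have : f = MulAction.toEndHom (finRotate 5) := rfl
    rw [this, ← map_pow, pow_one, h5, map_one]
  have : Fact (Nat.Prime 5) := ⟨Nat.prime_five⟩
  have hmod := Equiv.Perm.card_fixedPoints_modEq hf
  have hle : Fintype.card f.fixedPoints ≤ 6 := hF ▸ set_fintype_card_le_univ _
  have hne : Fintype.card f.fixedPoints ≠ 6 := by
    intro h
    have hall : f.fixedPoints = Set.univ := (set_fintype_card_eq_univ_iff _).mp (by rw [h, hF])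
    obtain ⟨x⟩ : Nonempty X := Fintype.card_pos_iff.mp (by omega)
    have hS : ∀ y : X, y ∈ ({x, swap (1 : Fin 5) 4 • x} : Finset X) := fun y =>
      mem_of_isPretransitive (S := {y | y ∈ ({x, swap (1 : Fin 5) 4 • x} : Finset X)})
        (x := x) (by simp)
        (fun y hy => by
          have : finRotate 5 • y = y := hall.ge (Set.mem_univ y)
          rwa [this])
        (fun y hy => by
          simp only [Finset.mem_insert, Finset.mem_singleton, Set.mem_ofPred_eq] at hy ⊢
          rcases hy with rfl | rfl
          · exact Or.inr rfl
          · exact Or.inl (swap_swap_smul x)) y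
    have := Finset.card_le_card (fun y _ => hS y : Finset.univ ⊆ _)
    have h2 := Finset.card_le_two (a := x) (b := swap (1 : Fin 5) 4 • x)
    rw [Finset.card_univ] at this
    omega
  have h1 : Fintype.card f.fixedPoints = 1 := by
    rw [hF] at hmod
    unfold Nat.ModEq at hmod
    omega
  obtain ⟨⟨p, hp⟩, hu⟩ := Fintype.card_eq_one_iff.mp h1
  exact ⟨p, hp, fun q hq => congrArg Subtype.val (hu ⟨q, hq⟩)⟩

/-- The parametrisation of `X` by the projective line, with `∞ ↦ p` and `0 ↦ y`. -/
def lineParam (p y : X) : Option (ZMod 5) → X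
  | none => p
  | some k => finRotate 5 ^ k.val • y

theorem lineParam_bijective (hX : Nat.card X = 6) {p y : X} (hp : finRotate 5 • p = p)
    (hu : ∀ q : X, finRotate 5 • q = q → q = p) (hy : y ≠ p) :
    Function.Bijective (lineParam p y) := by
  have : Finite X := Nat.finite_of_card_ne_zero (by omega)
  have hne : ∀ k : ZMod 5, finRotate 5 ^ k.val • y ≠ p := by
    intro k h
    apply hy
    have := finRotate_pow_add_smul (-k) k y
    rw [h, neg_add_cancel, ZMod.val_zero, pow_zero, one_smul] at this
    rw [this]
    have h2 : finRotate 5 ^ (-k).val ∈ MulAction.stabilizer (Perm (Fin 5)) p :=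
      Subgroup.pow_mem _ hp _
    exact h2
  rw [Nat.bijective_iff_injective_and_card]
  refine ⟨?_, by simp [hX]⟩
  rintro (_ | k) (_ | l) h
  · rfl
  · exact absurd h.symm (hne l)
  · exact absurd h (hne k)
  · by_contra hkl
    have hkl : l - k ≠ 0 := fun h => hkl (by rw [sub_eq_zero.mp h])
    refine hy (hu y (finRotate_smul_eq_of_pow hkl ?_))
    have h' : finRotate 5 ^ k.val • y = finRotate 5 ^ l.val • y := h
    rw [sub_eq_neg_add, finRotate_pow_add_smul, ← h', ← finRotate_pow_add_smul, neg_add_cancel]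
    simp

/-- `∞` is the fixed point of the 5-cycle and `0` a second fixed point of `doublePerm`. The
transposition `(1 4)` inverts `doublePerm` by conjugation, so it acts as `z ↦ k / z`; a power of
`doublePerm` normalises `k` to `1`. -/
theorem exists_line_coordinates [MulAction.IsPretransitive (Perm (Fin 5)) X]
    (hX : Nat.card X = 6) :
    ∃ (e : X ≃ Option (ZMod 5)) (t : Perm (Fin 5)),
      Subgroup.closure {finRotate 5, doublePerm, t} = ⊤ ∧
      t * t = 1 ∧ doublePerm * t * doublePerm = t ∧
      (∀ x, e (finRotate 5 • x) = lineShift (e x)) ∧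
      (∀ x, e (doublePerm • x) = lineDouble (e x)) ∧
      (∀ x, e (t • x) = lineInv (e x)) := by
  have : Finite X := Nat.finite_of_card_ne_zero (by omega)
  obtain ⟨p, hp, hu⟩ := exists_unique_finRotate_fixed hX
  have hbp : doublePerm • p = p := by
    apply hu
    -- As `2 * 3 = 1` in `ℤ/5`, `doublePerm` conjugates the cube of the 5-cycle to the 5-cycle
    -- itself.
    have h := doublePerm_finRotate_pow_smul 3 p
    have h3 : finRotate 5 ^ (3 : ZMod 5).val • p = p :=
      (Subgroup.pow_mem _ hp _ : _ ∈ MulAction.stabilizer (Perm (Fin 5)) p)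
    rw [h3] at h
    have h6 : finRotate 5 ^ (2 * 3 : ZMod 5).val = finRotate 5 := by decide
    rw [h6] at h
    exact h.symm
  obtain ⟨y, hy, hby⟩ : ∃ y : X, y ≠ p ∧ doublePerm • y = y := by
    have : Nontrivial X := Finite.one_lt_card_iff_nontrivial.mp (by omega)
    obtain ⟨y, hy⟩ := exists_ne p
    have hB := lineParam_bijective hX hp hu hy
    obtain ⟨o, ho⟩ := hB.2 (doublePerm • y)
    rcases o with _ | k
    · have : p = doublePerm • y := ho
      rw [← hbp] at this
      exact absurd (MulAction.injective _ this).symm hy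
    · have hk : finRotate 5 ^ k.val • y = doublePerm • y := ho
      -- With origin `y`, `doublePerm` acts as `z ↦ 2 z + k`, which fixes `-k`.
      refine ⟨finRotate 5 ^ (-k).val • y, fun h => ?_, ?_⟩
      · exact absurd (hB.1 (a₁ := some (-k)) (a₂ := none) h) (by simp)
      · rw [doublePerm_finRotate_pow_smul, ← hk, ← finRotate_pow_add_smul]
        congr 3
        ring
  have hB := lineParam_bijective hX hp hu hy
  have hc : ∀ o, finRotate 5 • lineParam p y o = lineParam p y (lineShift o) := by
    rintro (_ | k)
    · exact hp
    · have := finRotate_pow_add_smul 1 k y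
      rw [show finRotate 5 ^ (1 : ZMod 5).val = finRotate 5 by decide] at this
      exact this.symm
  have hb : ∀ o, doublePerm • lineParam p y o = lineParam p y (lineDouble o) := by
    rintro (_ | k)
    · exact hbp
    · change doublePerm • finRotate 5 ^ k.val • y = _
      rw [doublePerm_finRotate_pow_smul, hby]
      rfl
  -- the involution exchanges `∞` and `0`
  have htp : swap (1 : Fin 5) 4 • p = y := by
    obtain ⟨o, ho⟩ := hB.2 (swap (1 : Fin 5) 4 • p)
    -- The image of `p` is again fixed by `doublePerm`, so it is `∞` or `0`; the value `∞` would
    -- make `{p}` invariant under the whole group.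
    have h1 : doublePerm • swap (1 : Fin 5) 4 • p = swap (1 : Fin 5) 4 • p := by
      conv_lhs => rw [← hbp]
      exact doublePerm_swap_doublePerm_smul p
    rw [← ho, hb] at h1
    have h2 := hB.1 h1
    have h3 : ∀ o, lineDouble o = o → o = none ∨ o = some 0 := by decide
    rcases h3 o h2 with rfl | rfl
    · exfalso
      have h4 : swap (1 : Fin 5) 4 • p = p := ho.symm
      refine hy (mem_of_isPretransitive (S := {p}) (x := p) rfl ?_ ?_ y)
      · rintro _ rfl; exact hp
      · rintro _ rfl; exact h4
    · rw [← ho]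
      simp [lineParam]
  have hty : swap (1 : Fin 5) 4 • y = p := by rw [← htp, swap_swap_smul]
  obtain ⟨T, hT⟩ : ∃ T : Option (ZMod 5) → Option (ZMod 5),
      ∀ o, swap (1 : Fin 5) 4 • lineParam p y o = lineParam p y (T o) :=
    ⟨fun o => (hB.2 (swap (1 : Fin 5) 4 • lineParam p y o)).choose,
      fun o => (hB.2 (swap (1 : Fin 5) 4 • lineParam p y o)).choose_spec.symm⟩
  have hT0 : T (some 0) = none := hB.1 (by
    rw [← hT]; simpa [lineParam] using hty)
  have hTn : T none = some 0 := hB.1 (by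
    rw [← hT]; simpa [lineParam] using htp)
  have hTi : Function.Injective T := fun a b hab => hB.1 (MulAction.injective (swap (1 : Fin 5) 4)
    (by simp only [hT, hab]))
  -- This says `T (2 z) = T z / 2`, so the value `k` at `1` determines `T` on the nonzero `z`.
  have hTb : ∀ o, lineDouble (T (lineDouble o)) = T o := fun o => hB.1 (by
    rw [← hb, ← hT, ← hb, ← hT, doublePerm_swap_doublePerm_smul])
  obtain ⟨k, hk, hk0⟩ : ∃ k : ZMod 5, T (some 1) = some k ∧ k ≠ 0 := by
    rcases h : T (some 1) with _ | k
    · exact absurd (hTi (h.trans hT0.symm)) (by decide)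
    · refine ⟨k, rfl, ?_⟩
      rintro rfl
      exact absurd (hTi (h.trans hTn.symm)) (by decide)
  -- The class of `2` generates `(ℤ/5)ˣ`, so repeated doubling cancels `k`.
  have key : ∀ k : ZMod 5, k ≠ 0 → ∃ j : Fin 4, ∀ z : ZMod 5, z ≠ 0 →
      lineDouble^[j] (some (k * z ^ 3)) = some (z ^ 3) := by decide
  have hTz : ∀ z : ZMod 5, z ≠ 0 → T (some z) = some (k * z ^ 3) := by
    have inj : Function.Injective lineDouble := by decide
    have h2 : T (some 2) = some (k * 2 ^ 3) := by
      have h := hTb (some 1)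
      rw [hk] at h
      apply inj
      refine Eq.trans h ?_
      exact congrArg some (by ring_nf; reduce_mod_char)
    have h4 : T (some 4) = some (k * 4 ^ 3) := by
      have h := hTb (some 2)
      rw [h2] at h
      apply inj
      refine Eq.trans h ?_
      exact congrArg some (by ring_nf; reduce_mod_char)
    have h3 : T (some 3) = some (k * 3 ^ 3) := by
      have h := hTb (some 4)
      rw [h4] at h
      apply inj
      refine Eq.trans h ?_
      exact congrArg some (by ring_nf; reduce_mod_char)
    intro z hz
    have : z = 1 ∨ z = 2 ∨ z = 3 ∨ z = 4 := by revert z; decide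
    rcases this with rfl | rfl | rfl | rfl
    · simpa using hk
    · exact h2
    · exact h3
    · exact h4
  obtain ⟨j, hj⟩ := key k hk0
  have hbj : ∀ (n : ℕ) o, doublePerm ^ n • lineParam p y o = lineParam p y (lineDouble^[n] o) := by
    intro n
    induction n with
    | zero => intro o; simp
    | succ n ih => intro o; rw [pow_succ, mul_smul, hb, ih, Function.iterate_succ_apply]
  have ht : ∀ o, (doublePerm ^ (j : ℕ) * swap (1 : Fin 5) 4) • lineParam p y o =
      lineParam p y (lineInv o) := by
    intro o
    rw [mul_smul, hT, hbj]
    congr 1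
    rcases o with _ | z
    · rw [hTn]
      exact Function.iterate_fixed (by decide) _
    · by_cases hz : z = 0
      · subst hz
        rw [hT0]
        exact Function.iterate_fixed (by decide) _
      · rw [hTz z hz, hj z hz]
        simp [lineInv, hz]
  let E := Equiv.ofBijective _ hB
  have hE : ∀ (g : Perm (Fin 5)) (F : Option (ZMod 5) → Option (ZMod 5)),
      (∀ o, g • lineParam p y o = lineParam p y (F o)) → ∀ x, E.symm (g • x) = F (E.symm x) := by
    intro g F h x
    rw [Equiv.symm_apply_eq]
    have := h (E.symm x)
    change _ = E (F (E.symm x)) at this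
    rw [← this]
    change _ = g • E (E.symm x)
    rw [E.apply_symm_apply]
  refine ⟨E.symm, doublePerm ^ (j : ℕ) * swap (1 : Fin 5) 4, ?_, ?_, ?_, hE _ _ hc, hE _ _ hb,
    hE _ _ ht⟩
  rotate_left
  · clear * -; revert j; decide
  · clear * -; revert j; decide
  rw [← top_le_iff, ← closure_finRotate_swap, Subgroup.closure_le]
  rintro _ (rfl | rfl)
  · exact Subgroup.subset_closure (by simp)
  · have h1 : doublePerm ∈ Subgroup.closure
        {finRotate 5, doublePerm, doublePerm ^ (j : ℕ) * swap (1 : Fin 5) 4} :=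
      Subgroup.subset_closure (by simp)
    refine (Subgroup.mul_mem_cancel_left _ (Subgroup.pow_mem _ h1 j)).mp
      (Subgroup.subset_closure (by simp))

end Coordinates

namespace WreathSemi

theorem mk_mem_conj_inl {G X A : Type*} [Group G] [MulAction G X] [CommGroup A]
    {K : Subgroup (WreathSemi G X A)} (m : X → A) {f g : X → A} {σ : G}
    (hf : (⟨f, σ⟩ : WreathSemi G X A) ∈ K) (h : ∀ x, g (σ • x) * m x = m (σ • x) * f (σ • x)) :
    (⟨g, σ⟩ : WreathSemi G X A) ∈ K.map (MulAut.conj (SemidirectProduct.inl m)).toMonoidHom := by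
  refine ⟨_, hf, SemidirectProduct.ext (funext fun x => ?_) (inl_conj_right m _)⟩
  refine (inl_conj_left m _ x).trans ?_
  have := h (σ⁻¹ • x)
  rw [smul_inv_smul] at this
  rw [mul_inv_eq_iff_eq_mul]
  exact this.symm

end WreathSemi

/-- The sign function attached to `z ↦ 2 z` in an extension in normal form. -/
def doubleSign (ε : ℤˣ) : Option (ZMod 5) → ℤˣ
  | none => ε
  | some _ => 1

/-- The sign function attached to `z ↦ 1 / z` in an extension in normal form. -/
def invSign (ε : ℤˣ) : Option (ZMod 5) → ℤˣ
  | none => 1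
  | some z => if z = 2 ∨ z = 3 then ε else 1

/-! ### Normal forms: at most two conjugacy classes. -/

section NormalForm

variable {X : Type*} [MulAction (Perm (Fin 5)) X] (e : X ≃ Option (ZMod 5)) (t : Perm (Fin 5))

/-- The extension `K` contains the lifts of the three generators given by the trivial function,
`doubleSign ε` and `invSign ε`. -/
def IsNormalForm (ε : ℤˣ) (K : Subgroup (WreathSemi (Perm (Fin 5)) X ℤˣ)) : Prop :=
  (⟨fun _ => 1, finRotate 5⟩ : WreathSemi (Perm (Fin 5)) X ℤˣ) ∈ K ∧
    (⟨fun x => doubleSign ε (e x), doublePerm⟩ : WreathSemi (Perm (Fin 5)) X ℤˣ) ∈ K ∧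
      (⟨fun x => invSign ε (e x), t⟩ : WreathSemi (Perm (Fin 5)) X ℤˣ) ∈ K

/-- The equation is solved recursively along the 5-cycle; the hypothesis is the condition for the
solution to close up, since `s ^ 5 = s`. -/
theorem exists_coboundary (F : Option (ZMod 5) → ℤˣ)
    (hF : F (some 0) * (F (some 4) * (F (some 3) * (F (some 2) * F (some 1)))) = F none) :
    ∃ (M : Option (ZMod 5) → ℤˣ) (s : ℤˣ), ∀ o, s * M o = M (lineShift o) * F (lineShift o) := by
  have key : ∀ a₀ a₁ a₂ a₃ a₄ s : ℤˣ, a₀ * (a₄ * (a₃ * (a₂ * a₁))) = s →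
      s * 1 = 1 * s ∧ s * 1 = s * a₁ * a₁ ∧ s * (s * a₁) = a₁ * a₂ * a₂ ∧
      s * (a₁ * a₂) = s * a₁ * a₂ * a₃ * a₃ ∧ s * (s * a₁ * a₂ * a₃) = a₁ * a₂ * a₃ * a₄ * a₄ ∧
      s * (a₁ * a₂ * a₃ * a₄) = 1 * a₀ := by decide
  obtain ⟨h, h0, h1, h2, h3, h4⟩ := key _ _ _ _ _ _ hF
  -- The value at `k` is `s ^ k * F 1 * ... * F k` with `s = F none`.
  refine ⟨fun o => o.elim 1 ![1, F none * F (some 1), F (some 1) * F (some 2),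
    F none * F (some 1) * F (some 2) * F (some 3),
    F (some 1) * F (some 2) * F (some 3) * F (some 4)], F none, ?_⟩
  rintro (_ | z)
  · exact h
  · have : z = 0 ∨ z = 1 ∨ z = 2 ∨ z = 3 ∨ z = 4 := by revert z; decide
    rcases this with rfl | rfl | rfl | rfl | rfl <;> assumption

section

variable {e t} {K : Subgroup (WreathSemi (Perm (Fin 5)) X ℤˣ)}
  (hc : ∀ x, e (finRotate 5 • x) = lineShift (e x))
  (hb : ∀ x, e (doublePerm • x) = lineDouble (e x))
  (ht : ∀ x, e (t • x) = lineInv (e x))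

theorem smul_symm_of_apply_smul {σ : Perm (Fin 5)} {S : Option (ZMod 5) → Option (ZMod 5)}
    (h : ∀ x, e (σ • x) = S (e x)) (o : Option (ZMod 5)) : σ • e.symm o = e.symm (S o) := by
  rw [Equiv.eq_symm_apply, h, e.apply_symm_apply]

theorem inv_smul_symm_of_apply_smul {σ : Perm (Fin 5)} {S : Option (ZMod 5) → Option (ZMod 5)}
    (h : ∀ x, e (σ • x) = S (e x)) (o : Option (ZMod 5)) : σ⁻¹ • e.symm (S o) = e.symm o := by
  rw [inv_smul_eq_iff, smul_symm_of_apply_smul h]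

include hc in
-- The fifth power of a lift of the 5-cycle is a constant function. Its value at `∞` is `f(∞) ^ 5 =
-- f(∞)` and at `0` the product of `f` over the finite points, so `f` is a constant times a
-- coboundary.
theorem exists_conj_finRotate_mem (hK : K ∈ WreathSemi.extensions (Perm (Fin 5)) X ℤˣ) :
    ∃ K' ∈ subgroupConjClass K, K' ∈ WreathSemi.extensions (Perm (Fin 5)) X ℤˣ ∧
      (⟨fun _ => 1, finRotate 5⟩ : WreathSemi (Perm (Fin 5)) X ℤˣ) ∈ K' := by
  obtain ⟨f, hf⟩ := WreathSemi.exists_mem_right hK (finRotate 5)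
  obtain ⟨s, hs⟩ := WreathSemi.left_const hK
    (K.mul_mem hf (K.mul_mem hf (K.mul_mem hf (K.mul_mem hf hf))))
    (show finRotate 5 * (finRotate 5 * (finRotate 5 * (finRotate 5 * finRotate 5))) = 1 by decide)
  have hi := inv_smul_symm_of_apply_smul hc
  have hn : (finRotate 5)⁻¹ • e.symm none = e.symm none := hi none
  have h0 : (finRotate 5)⁻¹ • e.symm (some 0) = e.symm (some 4) := hi (some 4)
  have h1 : (finRotate 5)⁻¹ • e.symm (some 4) = e.symm (some 3) := hi (some 3)
  have h2 : (finRotate 5)⁻¹ • e.symm (some 3) = e.symm (some 2) := hi (some 2)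
  have h3 : (finRotate 5)⁻¹ • e.symm (some 2) = e.symm (some 1) := hi (some 1)
  have hs1 := hs (e.symm none)
  have hs2 := hs (e.symm (some 0))
  simp only [WreathSemi.mul_left_apply, hn, h0, h1, h2, h3] at hs1 hs2
  obtain ⟨M, a, hM⟩ := exists_coboundary (fun o => f (e.symm o)) (by
    refine hs2.trans (hs1.symm.trans ?_)
    rcases Int.units_eq_one_or (f (e.symm none)) with h | h <;> rw [h] <;> rfl)
  refine ⟨_, ⟨_, rfl⟩, WreathSemi.conj_mem_extensions _ hK,
    WreathSemi.const_mul_mem (WreathSemi.conj_mem_extensions _ hK) a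
      (WreathSemi.mk_mem_conj_inl (fun x => M (e x)) (g := fun _ => a) hf fun x => ?_)
      fun _ => (Int.units_mul_self a).symm⟩
  have := hM (e x)
  rwa [← hc, e.symm_apply_apply] at this

include hc in
-- The relation `b c = c² b`, with `c` the 5-cycle, lifts up to a sign, which evaluation at the
-- fixed point `∞` shows to be `1`. Then `f (z + 2) = f z`, so `f` is constant on the finite points.
theorem exists_doublePerm_mem (hK : K ∈ WreathSemi.extensions (Perm (Fin 5)) X ℤˣ)
    (hcK : (⟨fun _ => 1, finRotate 5⟩ : WreathSemi (Perm (Fin 5)) X ℤˣ) ∈ K) :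
    ∃ ε, (⟨fun x => doubleSign ε (e x), doublePerm⟩ : WreathSemi (Perm (Fin 5)) X ℤˣ) ∈ K := by
  obtain ⟨f, hf⟩ := WreathSemi.exists_mem_right hK doublePerm
  obtain ⟨s, hs⟩ := WreathSemi.left_eq_const_mul hK (K.mul_mem hf hcK)
    (K.mul_mem hcK (K.mul_mem hcK hf))
    (show doublePerm * finRotate 5 = finRotate 5 * (finRotate 5 * doublePerm) by decide)
  simp only [WreathSemi.mul_left_apply, mul_one, one_mul] at hs
  have hi := inv_smul_symm_of_apply_smul hc
  have hn : (finRotate 5)⁻¹ • e.symm none = e.symm none := hi none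
  have hs1 : s = 1 := by
    have := hs (e.symm none)
    rw [hn, hn] at this
    simpa using this
  subst hs1
  simp only [one_mul] at hs
  have hstep : ∀ z : ZMod 5, f (e.symm (some (1 + (1 + z)))) = f (e.symm (some z)) := fun z => by
    have := hs (e.symm (some (1 + (1 + z))))
    have h1 : (finRotate 5)⁻¹ • e.symm (some (1 + (1 + z))) = e.symm (some (1 + z)) :=
      hi (some (1 + z))
    have h2 : (finRotate 5)⁻¹ • e.symm (some (1 + z)) = e.symm (some z) := hi (some z)
    rwa [h1, h2] at this
  have hconst : ∀ z : ZMod 5, f (e.symm (some z)) = f (e.symm (some 0)) := by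
    have h2 : f (e.symm (some 2)) = f (e.symm (some 0)) := hstep 0
    have h4 : f (e.symm (some 4)) = f (e.symm (some 2)) := hstep 2
    have h1 : f (e.symm (some 1)) = f (e.symm (some 4)) := hstep 4
    have h3 : f (e.symm (some 3)) = f (e.symm (some 1)) := hstep 1
    intro z
    have : z = 0 ∨ z = 1 ∨ z = 2 ∨ z = 3 ∨ z = 4 := by revert z; decide
    rcases this with rfl | rfl | rfl | rfl | rfl
    · rfl
    · rw [h1, h4, h2]
    · rw [h2]
    · rw [h3, h1, h4, h2]
    · rw [h4, h2]
  refine ⟨f (e.symm (some 0)) * f (e.symm none),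
    WreathSemi.const_mul_mem hK (f (e.symm (some 0))) hf fun x => ?_⟩
  obtain ⟨o, rfl⟩ := e.symm.surjective x
  rw [e.apply_symm_apply]
  rcases o with _ | z
  · rfl
  · rw [hconst z]
    exact (Int.units_mul_self _).symm

include hc hb ht in
-- For a lift `f` of `t`, the value at `1` makes the sign in `t² = 1` trivial, so `f 0 = f ∞`. The
-- sign in `b t b = t` is `ε` by evaluation at `∞`, which yields `f 2 = f 3 = ε f 1` and `f 4 = f
-- 1`.
theorem exists_conj_isNormalForm (hK : K ∈ WreathSemi.extensions (Perm (Fin 5)) X ℤˣ)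
    (h2 : t * t = 1) (hbt : doublePerm * t * doublePerm = t) :
    ∃ K' ∈ subgroupConjClass K, K' ∈ WreathSemi.extensions (Perm (Fin 5)) X ℤˣ ∧
      ∃ ε, IsNormalForm e t ε K' := by
  obtain ⟨K₁, hKK₁, hK₁, hcK₁⟩ := exists_conj_finRotate_mem hc hK
  obtain ⟨ε, hbK₁⟩ := exists_doublePerm_mem hc hK₁ hcK₁
  obtain ⟨f, hf⟩ := WreathSemi.exists_mem_right hK₁ t
  have hi := inv_smul_symm_of_apply_smul ht
  have hin : t⁻¹ • e.symm none = e.symm (some 0) := hi (some 0)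
  have hi0 : t⁻¹ • e.symm (some 0) = e.symm none := hi none
  have hi1 : t⁻¹ • e.symm (some 1) = e.symm (some 1) := hi (some 1)
  have hi3 : t⁻¹ • e.symm (some 3) = e.symm (some 2) := hi (some 2)
  have hi4 : t⁻¹ • e.symm (some 4) = e.symm (some 4) := hi (some 4)
  have hj := inv_smul_symm_of_apply_smul hb
  have hjn : doublePerm⁻¹ • e.symm none = e.symm none := hj none
  have hj1 : doublePerm⁻¹ • e.symm (some 1) = e.symm (some 3) := hj (some 3)
  have hj2 : doublePerm⁻¹ • e.symm (some 2) = e.symm (some 1) := hj (some 1)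
  have hj3 : doublePerm⁻¹ • e.symm (some 3) = e.symm (some 4) := hj (some 4)
  obtain ⟨s, hs⟩ := WreathSemi.left_const hK₁ (K₁.mul_mem hf hf) h2
  obtain ⟨r, hr⟩ := WreathSemi.left_eq_const_mul hK₁ (K₁.mul_mem (K₁.mul_mem hbK₁ hf) hbK₁) hf hbt
  have s1 := hs (e.symm (some 1))
  have s0 := hs (e.symm (some 0))
  have rn := hr (e.symm none)
  have r1 := hr (e.symm (some 1))
  have r2 := hr (e.symm (some 2))
  have r3 := hr (e.symm (some 3))
  simp only [WreathSemi.mul_left_apply, SemidirectProduct.mul_right, mul_inv_rev, mul_smul, hi0,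
    hin, hi1, hi3, hi4, hjn, hj1, hj2, hj3, Equiv.apply_symm_apply, doubleSign]
    at s0 s1 rn r1 r2 r3
  have key : ∀ ε s r fn f0 f1 f2 f3 f4 : ℤˣ, f0 * fn = s → f1 * f1 = s → ε * fn * 1 = r * fn →
      1 * f3 * 1 = r * f1 → 1 * f1 * 1 = r * f2 → 1 * f4 * 1 = r * f3 →
      f0 = fn ∧ f2 = f1 * ε ∧ f3 = f1 * ε ∧ f4 = f1 := by decide
  obtain ⟨e0, e2, e3, e4⟩ := key _ _ _ _ _ _ _ _ _ s0 s1 rn r1 r2 r3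
  -- Nontrivial at most at `∞`, this function leaves the lifts of the two generators fixing `∞`
  -- unchanged, and aligns the values of the lift of `t` at `0` and `∞` with its value at `1`.
  set m : X → ℤˣ := fun x => doubleSign (f (e.symm none) * f (e.symm (some 1))) (e x) with hm
  have hK₂ := WreathSemi.conj_mem_extensions (SemidirectProduct.inl m) hK₁
  refine ⟨_, mem_subgroupConjClass_trans hKK₁ ⟨SemidirectProduct.inl m, rfl⟩, hK₂, ε,
    WreathSemi.mk_mem_conj_inl m hcK₁ fun x => ?_, WreathSemi.mk_mem_conj_inl m hbK₁ fun x => ?_,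
    WreathSemi.const_mul_mem hK₂ (f (e.symm (some 1))) (WreathSemi.mk_mem_conj_inl m
      (g := fun x => f (e.symm (some 1)) * invSign ε (e x)) hf fun x => ?_)
      fun x => by rw [← mul_assoc, Int.units_mul_self, one_mul]⟩
  · simp only [hm, hc, one_mul, mul_one]
    cases e x <;> rfl
  · simp only [hm, hb]
    rcases e x with _ | z
    · exact mul_comm _ _
    · rfl
  · obtain ⟨o, rfl⟩ := e.symm.surjective x
    simp only [hm, smul_symm_of_apply_smul ht, Equiv.apply_symm_apply]
    have key' : ∀ fn f1 ε : ℤˣ, f1 * 1 * (fn * f1) = 1 * fn ∧ f1 * 1 * 1 = fn * f1 * fn ∧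
        f1 * 1 * 1 = 1 * f1 ∧ f1 * ε * 1 = 1 * (f1 * ε) := by decide
    obtain ⟨k0, k1, k2, k3⟩ := key' (f (e.symm none)) (f (e.symm (some 1))) ε
    rcases o with _ | z
    · exact k0.trans (by rw [← e0]; rfl)
    · have : z = 0 ∨ z = 1 ∨ z = 2 ∨ z = 3 ∨ z = 4 := by revert z; decide
      rcases this with rfl | rfl | rfl | rfl | rfl
      · exact k1
      · exact k2
      · exact k3.trans (by rw [← e3]; rfl)
      · exact k3.trans (by rw [← e2]; rfl)
      · exact k2.trans (by rw [← e4]; rfl)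

theorem IsNormalForm.eq (hcl : Subgroup.closure {finRotate 5, doublePerm, t} = ⊤)
    {K' : Subgroup (WreathSemi (Perm (Fin 5)) X ℤˣ)} {ε : ℤˣ}
    (hK : K ∈ WreathSemi.extensions (Perm (Fin 5)) X ℤˣ)
    (hK' : K' ∈ WreathSemi.extensions (Perm (Fin 5)) X ℤˣ)
    (h : IsNormalForm e t ε K) (h' : IsNormalForm e t ε K') : K = K' := by
  refine WreathSemi.eq_of_map_inf_eq_top hK hK' (top_le_iff.mp ?_)
  rw [← hcl, Subgroup.closure_le]
  rintro _ (rfl | rfl | rfl)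
  · exact ⟨_, ⟨h.1, h'.1⟩, rfl⟩
  · exact ⟨_, ⟨h.2.1, h'.2.1⟩, rfl⟩
  · exact ⟨_, ⟨h.2.2, h'.2.2⟩, rfl⟩

theorem isNormalForm_one_splitExt :
    IsNormalForm e t 1 (WreathSemi.splitExt (Perm (Fin 5)) X ℤˣ) := by
  have h : ∀ (F : Option (ZMod 5) → ℤˣ) (σ : Perm (Fin 5)), (∀ o, F o = 1) →
      (⟨fun x => F (e x), σ⟩ : WreathSemi (Perm (Fin 5)) X ℤˣ) ∈
        WreathSemi.splitExt (Perm (Fin 5)) X ℤˣ := by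
    intro F σ hF
    simp only [hF]
    exact WreathSemi.inr_mem_splitExt σ
  exact ⟨h (fun _ => 1) _ fun _ => rfl, h _ _ (by decide), h _ _ (by decide)⟩

end

theorem mem_subgroupConjClass_of_not_split [MulAction.IsPretransitive (Perm (Fin 5)) X]
    (hX : Nat.card X = 6) {K K' : Subgroup (WreathSemi (Perm (Fin 5)) X ℤˣ)}
    (hK : K ∈ WreathSemi.extensions (Perm (Fin 5)) X ℤˣ)
    (hK' : K' ∈ WreathSemi.extensions (Perm (Fin 5)) X ℤˣ)
    (h : K ∉ subgroupConjClass (WreathSemi.splitExt (Perm (Fin 5)) X ℤˣ))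
    (h' : K' ∉ subgroupConjClass (WreathSemi.splitExt (Perm (Fin 5)) X ℤˣ)) :
    K' ∈ subgroupConjClass K := by
  obtain ⟨e, t, hcl, h2, hbt, hc, hb, ht⟩ := exists_line_coordinates hX
  have key : ∀ K ∈ WreathSemi.extensions (Perm (Fin 5)) X ℤˣ,
      K ∉ subgroupConjClass (WreathSemi.splitExt (Perm (Fin 5)) X ℤˣ) →
      ∃ K₁ ∈ subgroupConjClass K, K₁ ∈ WreathSemi.extensions (Perm (Fin 5)) X ℤˣ ∧
        IsNormalForm e t (-1) K₁ := by
    intro K hK h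
    obtain ⟨K₁, hKK₁, hK₁, ε, hε⟩ := exists_conj_isNormalForm hc hb ht hK h2 hbt
    rcases Int.units_eq_one_or ε with rfl | rfl
    · have := hε.eq hcl hK₁ WreathSemi.splitExt_mem_extensions isNormalForm_one_splitExt
      exact absurd (mem_subgroupConjClass_symm (this ▸ hKK₁)) h
    · exact ⟨K₁, hKK₁, hK₁, hε⟩
  obtain ⟨K₁, hKK₁, hK₁, hn⟩ := key K hK h
  obtain ⟨K₂, hKK₂, hK₂, hn'⟩ := key K' hK' h'
  have := hn.eq hcl hK₁ hK₂ hn'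
  subst this
  exact mem_subgroupConjClass_trans hKK₁ (mem_subgroupConjClass_symm hKK₂)

end NormalForm

/-! ### The action of matrices on pairs of vectors up to sign. -/

section PairAction

variable {X : Type*} [MulAction (Perm (Fin 5)) X]

/-- The matrix `M` acts on the vectors `v x`, up to sign, as the element `h` of `{±1}^X ⋊ S₅`. The
scalars `c` with `c ^ 2 = 1` are `±1`, and those with `c ^ 2 = -1` are `±2`. -/
def PairAction (v : X → Fin 2 → ZMod 5) (M : Matrix (Fin 2) (Fin 2) (ZMod 5))
    (h : WreathSemi (Perm (Fin 5)) X ℤˣ) : Prop :=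
  ∀ x, ∃ c : ZMod 5, c ^ 2 = ((h.left (h.right • x) : ℤ) : ZMod 5) ∧
    M.mulVec (v x) = c • v (h.right • x)

/-- Squaring identifies `(ℤ/5)ˣ / {±1}` with `{±1}`, which turns equality up to sign into a
condition multiplicative in `c`. -/
theorem eq_signScalar_smul_or_iff {a : ℤˣ} {w y : Fin 2 → ZMod 5} :
    (w = signScalar a • y ∨ w = -(signScalar a • y)) ↔
      ∃ c : ZMod 5, c ^ 2 = ((a : ℤ) : ZMod 5) ∧ w = c • y := by
  constructor
  · have h1 : ∀ a : ℤˣ, signScalar a ^ 2 = ((a : ℤ) : ZMod 5) ∧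
        (-signScalar a) ^ 2 = ((a : ℤ) : ZMod 5) := by decide
    rintro (rfl | rfl)
    · exact ⟨_, (h1 a).1, rfl⟩
    · exact ⟨_, (h1 a).2, (neg_smul _ _).symm⟩
  · rintro ⟨c, hc, rfl⟩
    have h2 : ∀ (a : ℤˣ) (c : ZMod 5), c ^ 2 = ((a : ℤ) : ZMod 5) →
        c = signScalar a ∨ c = -signScalar a := by decide
    rcases h2 a c hc with rfl | rfl
    · exact Or.inl rfl
    · exact Or.inr (neg_smul _ _)

theorem isNaturalHom_iff {ι : GLModPm →* WreathSemi (Perm (Fin 5)) X ℤˣ} :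
    IsNaturalHom ι ↔ ∃ v : X → Fin 2 → ZMod 5, IsPairSystem v ∧
      ∀ g : Matrix.GeneralLinearGroup (Fin 2) (ZMod 5), PairAction v g (ι (QuotientGroup.mk g)) :=
  exists_congr fun _ => and_congr_right fun _ => forall_congr' fun _ => forall_congr' fun _ =>
    eq_signScalar_smul_or_iff

theorem PairAction.one (v : X → Fin 2 → ZMod 5) : PairAction v 1 1 := fun x =>
  ⟨1, by simp, by simp⟩

theorem PairAction.mul {v : X → Fin 2 → ZMod 5} {M N : Matrix (Fin 2) (Fin 2) (ZMod 5)}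
    {h k : WreathSemi (Perm (Fin 5)) X ℤˣ} (hM : PairAction v M h) (hN : PairAction v N k) :
    PairAction v (M * N) (h * k) := by
  intro x
  obtain ⟨c, hc, hc'⟩ := hN x
  obtain ⟨d, hd, hd'⟩ := hM (k.right • x)
  refine ⟨c * d, ?_, ?_⟩
  · rw [mul_pow, hc, hd, WreathSemi.mul_left_apply, SemidirectProduct.mul_right, mul_smul,
      inv_smul_smul, Units.val_mul, Int.cast_mul, mul_comm]
  · rw [← Matrix.mulVec_mulVec, hc', Matrix.mulVec_smul, hd', smul_smul,
      SemidirectProduct.mul_right, mul_smul (h.right)]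

theorem IsPairSystem.eq_of_smul_eq {X : Type*} {v : X → Fin 2 → ZMod 5} (hv : IsPairSystem v)
    {a b : ℤˣ} {c d : ZMod 5} {x y : X} (hc : c ^ 2 = ((a : ℤ) : ZMod 5))
    (hd : d ^ 2 = ((b : ℤ) : ZMod 5)) (h : c • v x = d • v y) : a = b ∧ x = y := by
  have hc0 : c ≠ 0 := by
    rintro rfl
    revert a; decide
  have hw : c • v x ≠ 0 := by
    intro h0
    have h1 : c ^ 3 • c • v x = 0 := by rw [h0, smul_zero]
    have h2 : c ^ 3 * c = 1 := by clear * - hc0; revert c; decide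
    rw [smul_smul, h2, one_smul] at h1
    exact hv.1 x h1
  have := (hv.2 _ hw).unique (y₁ := (a, x)) (y₂ := (b, y))
    (eq_signScalar_smul_or_iff.mpr ⟨c, hc, rfl⟩) (eq_signScalar_smul_or_iff.mpr ⟨d, hd, h⟩)
  exact Prod.ext_iff.mp this

theorem IsPairSystem.exists_smul_eq {X : Type*} {v : X → Fin 2 → ZMod 5} (hv : IsPairSystem v)
    {w : Fin 2 → ZMod 5} (hw : w ≠ 0) :
    ∃ (x : X) (c : ZMod 5), w = c • v x := by
  obtain ⟨⟨a, x⟩, h, -⟩ := hv.2 w hw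
  obtain ⟨c, -, h⟩ := eq_signScalar_smul_or_iff.mp h
  exact ⟨x, c, h⟩

/-- The kernel meets the simple group `Alt₅` trivially because the 5-cycle moves `0`. Commutators
with `σ` lie in both, so `σ` is central in `S₅`; it then fixes the unique fixed point of
`doublePerm`, and with it all its translates. -/
theorem eq_one_of_forall_smul_eq [MulAction.IsPretransitive (Perm (Fin 5)) X]
    (hX : Nat.card X = 6) {σ : Perm (Fin 5)} (hσ : ∀ x : X, σ • x = x) : σ = 1 := by
  obtain ⟨e, t, hcl, h2, hbt, hc, hb, ht⟩ := exists_line_coordinates hX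
  have : IsSimpleGroup (alternatingGroup (Fin 5)) := alternatingGroup.isSimpleGroup (by simp)
  let N := (MulAction.toPermHom (Perm (Fin 5)) X).ker
  have hN : ∀ τ : Perm (Fin 5), τ ∈ N ↔ ∀ x : X, τ • x = x := fun τ => by
    rw [MonoidHom.mem_ker, Equiv.ext_iff]; rfl
  have hbot : N.subgroupOf (alternatingGroup (Fin 5)) = ⊥ := by
    refine (Subgroup.Normal.eq_bot_or_eq_top inferInstance).resolve_right fun h => ?_
    have h1 : finRotate 5 ∈ N := Subgroup.subgroupOf_eq_top.mp h
      (Equiv.Perm.mem_alternatingGroup.mpr (by decide))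
    have h3 := hc (e.symm (some 0))
    rw [(hN _).mp h1, e.apply_symm_apply] at h3
    exact absurd h3 (by decide)
  have hcomm : ∀ τ : Perm (Fin 5), σ * τ = τ * σ := by
    intro τ
    have h1 : σ * τ * σ⁻¹ * τ⁻¹ ∈ N := by
      have h1 : σ ∈ N := (hN σ).mpr hσ
      rw [mul_assoc, mul_assoc, ← mul_assoc τ]
      exact N.mul_mem h1 ((inferInstance : N.Normal).conj_mem _ (N.inv_mem h1) τ)
    have h4 : σ * τ * σ⁻¹ * τ⁻¹ ∈ alternatingGroup (Fin 5) := by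
      rw [Equiv.Perm.mem_alternatingGroup]
      simp only [map_mul, map_inv]
      rw [mul_right_comm (Perm.sign σ), mul_inv_cancel, one_mul, mul_inv_cancel]
    have h5 : (⟨_, h4⟩ : alternatingGroup (Fin 5)) ∈ N.subgroupOf (alternatingGroup (Fin 5)) :=
      h1
    rw [hbot, Subgroup.mem_bot] at h5
    have h6 : σ * τ * σ⁻¹ * τ⁻¹ = 1 := congrArg Subtype.val h5
    rwa [mul_inv_eq_one, mul_inv_eq_iff_eq_mul] at h6
  have h0 : σ 0 = 0 := by
    have h1 : σ 0 = doublePerm (σ 0) := congrArg (· 0) (hcomm doublePerm)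
    have h3 : ∀ i : Fin 5, i = doublePerm i → i = 0 := by decide
    exact h3 _ h1
  ext1 i
  have h1 : ∀ i : Fin 5, (finRotate 5 ^ i.val) 0 = i := by decide
  calc σ i = (σ * finRotate 5 ^ i.val) 0 := by rw [Perm.mul_apply, h1]
    _ = i := by rw [hcomm, Perm.mul_apply, h0, h1]

theorem PairAction.unique [MulAction.IsPretransitive (Perm (Fin 5)) X] (hX : Nat.card X = 6)
    {v : X → Fin 2 → ZMod 5} (hv : IsPairSystem v) {M : Matrix (Fin 2) (Fin 2) (ZMod 5)}
    {h k : WreathSemi (Perm (Fin 5)) X ℤˣ} (hh : PairAction v M h) (hk : PairAction v M k) :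
    h = k := by
  have key : ∀ x, h.left (h.right • x) = k.left (k.right • x) ∧ h.right • x = k.right • x := by
    intro x
    obtain ⟨c, hc, hc'⟩ := hh x
    obtain ⟨d, hd, hd'⟩ := hk x
    exact hv.eq_of_smul_eq hc hd (hc'.symm.trans hd')
  have hr : h.right = k.right := by
    have : k.right⁻¹ * h.right = 1 := eq_one_of_forall_smul_eq hX fun x => by
      rw [mul_smul, (key x).2, inv_smul_smul]
    rw [← inv_mul_eq_one, ← this, eq_comm, inv_mul_eq_one.mp this]
  refine SemidirectProduct.ext (funext fun x => ?_) hr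
  have := (key (h.right⁻¹ • x)).1
  rwa [smul_inv_smul, hr, smul_inv_smul] at this

/-- The vector `(1, 0)` or `(z, 1)` representing a point of the projective line. -/
def lineVec : Option (ZMod 5) → Fin 2 → ZMod 5
  | none => ![1, 0]
  | some z => ![z, 1]

theorem isPairSystem_lineVec : IsPairSystem lineVec := by
  refine ⟨by decide, ?_⟩
  have : ∀ a b : ZMod 5, ![a, b] ≠ 0 → ∃ p : ℤˣ × Option (ZMod 5),
      (![a, b] = signScalar p.1 • lineVec p.2 ∨ ![a, b] = -(signScalar p.1 • lineVec p.2)) ∧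
      ∀ q : ℤˣ × Option (ZMod 5),
        (![a, b] = signScalar q.1 • lineVec q.2 ∨ ![a, b] = -(signScalar q.1 • lineVec q.2)) →
          q = p := by
    decide
  intro w hw
  have e : w = ![w 0, w 1] := by ext i; fin_cases i <;> rfl
  obtain ⟨p, h1, h2⟩ := this (w 0) (w 1) (by rwa [← e])
  rw [← e] at h1 h2
  exact ⟨p, h1, h2⟩

theorem IsPairSystem.comp_equiv {X Y : Type*} {v : Y → Fin 2 → ZMod 5} (hv : IsPairSystem v)
    (e : X ≃ Y) : IsPairSystem (v ∘ e) := by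
  refine ⟨fun x => hv.1 (e x), fun w hw => ?_⟩
  obtain ⟨p, h1, h2⟩ := hv.2 w hw
  refine ⟨(p.1, e.symm p.2), by simpa using h1, fun q hq => ?_⟩
  have := h2 (q.1, e q.2) hq
  rw [← this]
  simp

/-- The property is multiplicative, so it is enough to check it on diagonal matrices and
transvections, all products of two explicit matrices and their conjugates by the antidiagonal one.
-/
theorem exists_pairAction_sign {e : X ≃ Option (ZMod 5)} {t : Perm (Fin 5)}
    (h2 : t * t = 1)
    (hc : ∀ x, e (finRotate 5 • x) = lineShift (e x))
    (hb : ∀ x, e (doublePerm • x) = lineDouble (e x))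
    (ht : ∀ x, e (t • x) = lineInv (e x))
    (M : Matrix (Fin 2) (Fin 2) (ZMod 5)) (hM : M.det ≠ 0) :
    ∃ h : WreathSemi (Perm (Fin 5)) X ℤˣ, PairAction (lineVec ∘ e) M h ∧
      M.det ^ 2 = ((Perm.sign h.right : ℤ) : ZMod 5) := by
  have lift : ∀ (N : Matrix (Fin 2) (Fin 2) (ZMod 5)) (σ : Perm (Fin 5))
      (S : Option (ZMod 5) → Option (ZMod 5)) (F : Option (ZMod 5) → ℤˣ),
      (∀ x, e (σ • x) = S (e x)) →
      (∀ o, ∃ c : ZMod 5, c ^ 2 = ((F (S o) : ℤ) : ZMod 5) ∧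
        N.mulVec (lineVec o) = c • lineVec (S o)) →
      PairAction (lineVec ∘ e) N ⟨fun x => F (e x), σ⟩ := by
    intro N σ S F hS hF x
    obtain ⟨c, h1, h2⟩ := hF (e x)
    refine ⟨c, ?_, ?_⟩
    · simpa only [hS] using h1
    · simpa only [Function.comp_apply, hS] using h2
  have hU := lift !![1, 1; 0, 1] (finRotate 5) lineShift (fun _ => 1) hc (by decide)
  have hD := lift !![2, 0; 0, 1] doublePerm lineDouble (doubleSign (-1)) hb (by decide)
  have hW := lift !![0, 1; 1, 0] t lineInv (invSign (-1)) ht (by decide)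
  let Q : Matrix (Fin 2) (Fin 2) (ZMod 5) → Prop := fun M =>
    ∃ h : WreathSemi (Perm (Fin 5)) X ℤˣ, PairAction (lineVec ∘ e) M h ∧
      M.det ^ 2 = ((Perm.sign h.right : ℤ) : ZMod 5)
  have Qone : Q 1 := ⟨1, PairAction.one _, by simp⟩
  have Qmul : ∀ A B, Q A → Q B → Q (A * B) := by
    rintro A B ⟨h, hA, hA'⟩ ⟨k, hB, hB'⟩
    refine ⟨h * k, hA.mul hB, ?_⟩
    rw [Matrix.det_mul, mul_pow, hA', hB', SemidirectProduct.mul_right, Perm.sign_mul,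
      Units.val_mul, Int.cast_mul]
  have Qpow : ∀ A (n : ℕ), Q A → Q (A ^ n) := by
    intro A n hA
    induction n with
    | zero => simpa using Qone
    | succ n ih => rw [pow_succ]; exact Qmul _ _ ih hA
  -- The parity of `t` is not known here, so the antidiagonal matrix is used only in conjugations,
  -- where its determinant and the sign of `t` both cancel.
  have hconj : ∀ {A : Matrix (Fin 2) (Fin 2) (ZMod 5)} {f : X → ℤˣ} {σ : Perm (Fin 5)},
      PairAction (lineVec ∘ e) A ⟨f, σ⟩ → A.det ^ 2 = ((Perm.sign σ : ℤ) : ZMod 5) →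
      Q (!![0, 1; 1, 0] * A * !![0, 1; 1, 0]) := by
    intro A f σ hA hA'
    refine ⟨_, (hW.mul hA).mul hW, ?_⟩
    have hs : Perm.sign (t * σ * t) = Perm.sign σ := by
      rw [Perm.sign_mul, Perm.sign_mul, mul_right_comm, ← Perm.sign_mul, h2, Perm.sign_one, one_mul]
    have hd : (!![0, 1; 1, 0] * A * !![0, 1; 1, 0]).det = A.det := by
      rw [Matrix.det_mul, Matrix.det_mul, mul_right_comm, ← Matrix.det_mul]
      have : (!![0, 1; 1, 0] * !![0, 1; 1, 0] : Matrix (Fin 2) (Fin 2) (ZMod 5)) = 1 := by decide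
      rw [this, Matrix.det_one, one_mul]
    change _ = ((Perm.sign (t * σ * t) : ℤ) : ZMod 5)
    rw [hs, hd, hA']
  have sU : (!![1, 1; 0, 1] : Matrix (Fin 2) (Fin 2) (ZMod 5)).det ^ 2 =
      ((Perm.sign (finRotate 5) : ℤ) : ZMod 5) := by decide
  have sD : (!![2, 0; 0, 1] : Matrix (Fin 2) (Fin 2) (ZMod 5)).det ^ 2 =
      ((Perm.sign doublePerm : ℤ) : ZMod 5) := by decide
  have QU : Q !![1, 1; 0, 1] := ⟨_, hU, sU⟩
  have QL := hconj hU sU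
  have QD : Q !![2, 0; 0, 1] := ⟨_, hD, sD⟩
  have QE := hconj hD sD
  have key₁ : ∀ a : ZMod 5, a ≠ 0 → ∃ m : Fin 4, Matrix.diagonal ![a, 1] =
      (!![2, 0; 0, 1] : Matrix (Fin 2) (Fin 2) (ZMod 5)) ^ (m : ℕ) := by decide
  have key₂ : ∀ a : ZMod 5, a ≠ 0 → ∃ m : Fin 4, Matrix.diagonal ![1, a] =
      (!![0, 1; 1, 0] * !![2, 0; 0, 1] * !![0, 1; 1, 0] : Matrix (Fin 2) (Fin 2) (ZMod 5)) ^
        (m : ℕ) := by decide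
  have key₃ : ∀ k : ZMod 5, Matrix.transvection (0 : Fin 2) 1 k = !![1, 1; 0, 1] ^ k.val := by
    decide
  have key₄ : ∀ k : ZMod 5, Matrix.transvection (1 : Fin 2) 0 k =
      (!![0, 1; 1, 0] * !![1, 1; 0, 1] * !![0, 1; 1, 0]) ^ k.val := by decide
  have : Fact (Nat.Prime 5) := ⟨Nat.prime_five⟩
  refine Matrix.diagonal_transvection_induction_of_det_ne_zero Q M hM ?_ ?_
    fun A B _ _ => Qmul A B
  · intro d hd
    have hd' : Matrix.diagonal d = Matrix.diagonal ![d 0, 1] * Matrix.diagonal ![1, d 1] := by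
      rw [Matrix.diagonal_mul_diagonal]
      congr 1
      ext i; fin_cases i <;> simp
    rw [Matrix.det_diagonal, Fin.prod_univ_two] at hd
    obtain ⟨m, hm⟩ := key₁ (d 0) (left_ne_zero_of_mul hd)
    obtain ⟨n, hn⟩ := key₂ (d 1) (right_ne_zero_of_mul hd)
    rw [hd']
    refine Qmul _ _ ?_ ?_
    · rw [hm]; exact Qpow _ _ QD
    · rw [hn]; exact Qpow _ _ QE
  · rintro ⟨i, j, hij, k⟩
    fin_cases i <;> fin_cases j
    · exact absurd rfl hij
    · change Q (Matrix.transvection 0 1 k)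
      rw [key₃]
      exact Qpow _ _ QU
    · change Q (Matrix.transvection 1 0 k)
      rw [key₄]
      exact Qpow _ _ QL
    · exact absurd rfl hij

end PairAction

/-! ### Natural homomorphisms and their images. -/

section NaturalHom

variable {X : Type*} [MulAction (Perm (Fin 5)) X]

/-- Every nonzero vector is an eigenvector of `M`; testing `(1, 0)`, `(0, 1)` and `(1, 1)` forces
`M` to be scalar. -/
theorem PairAction.eq_smul_one_of_right_eq_one {v : X → Fin 2 → ZMod 5} (hv : IsPairSystem v)
    {M : Matrix (Fin 2) (Fin 2) (ZMod 5)} {h : WreathSemi (Perm (Fin 5)) X ℤˣ}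
    (hM : PairAction v M h) (h1 : h.right = 1) :
    ∃ (a : ℤˣ) (c : ZMod 5), c ^ 2 = ((a : ℤ) : ZMod 5) ∧ M = c • (1 : Matrix _ _ _) ∧
      h = WreathSemi.diag (Perm (Fin 5)) X ℤˣ a := by
  have hx : ∀ x, ∃ c : ZMod 5, c ^ 2 = ((h.left x : ℤ) : ZMod 5) ∧ M.mulVec (v x) = c • v x := by
    intro x
    have := hM x
    simpa only [h1, one_smul] using this
  have hw : ∀ w : Fin 2 → ZMod 5, w ≠ 0 → ∃ (a : ℤˣ) (c : ZMod 5),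
      c ^ 2 = ((a : ℤ) : ZMod 5) ∧ M.mulVec w = c • w := by
    intro w hw
    obtain ⟨x, d, rfl⟩ := hv.exists_smul_eq hw
    obtain ⟨c, hc, hc'⟩ := hx x
    exact ⟨_, c, hc, by rw [Matrix.mulVec_smul, hc', smul_comm]⟩
  obtain ⟨a, c, hc, hc'⟩ := hw ![1, 0] (by decide)
  obtain ⟨-, d, -, hd'⟩ := hw ![0, 1] (by decide)
  obtain ⟨-, r, -, hr'⟩ := hw ![1, 1] (by decide)
  have hMc : M = c • (1 : Matrix _ _ _) := by
    have c0 := congrFun hc' 0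
    have c1 := congrFun hc' 1
    have d0 := congrFun hd' 0
    have d1 := congrFun hd' 1
    have r0 := congrFun hr' 0
    have r1 := congrFun hr' 1
    simp [Matrix.mulVec, dotProduct, Fin.sum_univ_two] at c0 c1 d0 d1 r0 r1
    ext i j
    fin_cases i <;> fin_cases j <;> simp_all
  refine ⟨a, c, hc, hMc, SemidirectProduct.ext (funext fun x => ?_) h1⟩
  obtain ⟨d, hd, hd'⟩ := hx x
  rw [hMc, Matrix.smul_mulVec, Matrix.one_mulVec] at hd'
  exact (hv.eq_of_smul_eq hc hd hd').1.symm

theorem pairAction_smul_one (v : X → Fin 2 → ZMod 5) {a : ℤˣ} {c : ZMod 5}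
    (h : c ^ 2 = ((a : ℤ) : ZMod 5)) :
    PairAction v (c • 1) (WreathSemi.diag (Perm (Fin 5)) X ℤˣ a) := fun x =>
  ⟨c, h, by simp [Matrix.smul_mulVec]⟩

/-- By uniqueness of the element acting like a given matrix, any choice of such elements is
multiplicative and sends `-1` to `1`. -/
theorem exists_hom_pairAction_sign [MulAction.IsPretransitive (Perm (Fin 5)) X]
    (hX : Nat.card X = 6) :
    ∃ (v : X → Fin 2 → ZMod 5) (ι : GLModPm →* WreathSemi (Perm (Fin 5)) X ℤˣ), IsPairSystem v ∧
      ∀ g : Matrix.GeneralLinearGroup (Fin 2) (ZMod 5), PairAction v g (ι (QuotientGroup.mk g)) ∧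
        (g : Matrix (Fin 2) (Fin 2) (ZMod 5)).det ^ 2 =
          ((Perm.sign (ι (QuotientGroup.mk g)).right : ℤ) : ZMod 5) := by
  have : Nontrivial (ZMod 5) := ⟨0, 1, by decide⟩
  obtain ⟨e, t, -, h2, -, hc, hb, ht⟩ := exists_line_coordinates hX
  have hv : IsPairSystem (lineVec ∘ e) := isPairSystem_lineVec.comp_equiv e
  have hex : ∀ g : Matrix.GeneralLinearGroup (Fin 2) (ZMod 5),
      ∃ h : WreathSemi (Perm (Fin 5)) X ℤˣ, PairAction (lineVec ∘ e) g h ∧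
        (g : Matrix (Fin 2) (Fin 2) (ZMod 5)).det ^ 2 = ((Perm.sign h.right : ℤ) : ZMod 5) :=
    fun g => exists_pairAction_sign h2 hc hb ht _
      ((Matrix.isUnit_iff_isUnit_det _).mp g.isUnit).ne_zero
  choose f hf hf' using hex
  let φ : Matrix.GeneralLinearGroup (Fin 2) (ZMod 5) →* WreathSemi (Perm (Fin 5)) X ℤˣ :=
    MonoidHom.mk' f fun g g' => (hf (g * g')).unique hX hv ((hf g).mul (hf g'))
  have hφ : pmOne ≤ φ.ker := by
    rw [pmOne, Subgroup.zpowers_le, MonoidHom.mem_ker]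
    refine (hf (-1)).unique hX hv fun x => ⟨-1, by simp, ?_⟩
    simp [Matrix.neg_mulVec]
  exact ⟨_, QuotientGroup.lift pmOne φ hφ, hv, fun g => ⟨hf g, hf' g⟩⟩

section

variable {v : X → Fin 2 → ZMod 5} (hv : IsPairSystem v)
  {ι : GLModPm →* WreathSemi (Perm (Fin 5)) X ℤˣ}
  (hι : ∀ g : Matrix.GeneralLinearGroup (Fin 2) (ZMod 5), PairAction v g (ι (QuotientGroup.mk g)))

include hv hι in
theorem injective_of_pairAction : Function.Injective ι := by
  rw [injective_iff_map_eq_one]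
  intro q hq
  obtain ⟨g, rfl⟩ := QuotientGroup.mk_surjective q
  obtain ⟨a, c, hc, hg, hd⟩ := (hι g).eq_smul_one_of_right_eq_one hv (by rw [hq]; rfl)
  have hX : Nonempty X := (hv.exists_smul_eq (w := ![1, 0]) (by decide)).nonempty
  obtain ⟨x⟩ := hX
  have ha : a = 1 := by
    have := congrArg (fun h => h.left x) (hd.symm.trans hq)
    exact this
  have hc1 : ∀ c : ZMod 5, c ^ 2 = 1 → c = 1 ∨ c = -1 := by decide
  rw [QuotientGroup.eq_one_iff, pmOne]
  rcases hc1 c (by rw [hc, ha]; simp) with rfl | rfl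
  · have : g = 1 := Units.ext (by rw [hg]; simp)
    rw [this]; exact Subgroup.one_mem _
  · have : g = -1 := Units.ext (by rw [hg]; simp)
    rw [this]; exact Subgroup.mem_zpowers _

include hv hι in
theorem diag_mem_range_of_pairAction [MulAction.IsPretransitive (Perm (Fin 5)) X]
    (hX : Nat.card X = 6) (a : ℤˣ) :
    ∃ (g : Matrix.GeneralLinearGroup (Fin 2) (ZMod 5)) (c : ZMod 5),
      (g : Matrix (Fin 2) (Fin 2) (ZMod 5)) = c • (1 : Matrix _ _ _) ∧
      c ^ 2 = ((a : ℤ) : ZMod 5) ∧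
      ι (QuotientGroup.mk g) = WreathSemi.diag (Perm (Fin 5)) X ℤˣ a := by
  have h : ∀ a : ℤˣ, ∃ c d : ZMod 5, c ^ 2 = ((a : ℤ) : ZMod 5) ∧ c * d = 1 := by decide
  obtain ⟨c, d, hc, hcd⟩ := h a
  let g : Matrix.GeneralLinearGroup (Fin 2) (ZMod 5) :=
    ⟨c • 1, d • 1, by simp [smul_smul, mul_comm d c, hcd], by simp [smul_smul, hcd]⟩
  exact ⟨g, c, rfl, hc, (hι g).unique hX hv (pairAction_smul_one v hc)⟩

include hv hι in
-- The kernel of `GL₂(ℤ/5) → S₅` consists of scalars, so it has at most 4 elements, and the image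
-- has at least `480 / 4 = 120`.
theorem exists_right_eq_of_pairAction (σ : Perm (Fin 5)) :
    ∃ g : Matrix.GeneralLinearGroup (Fin 2) (ZMod 5), (ι (QuotientGroup.mk g)).right = σ := by
  let φ : Matrix.GeneralLinearGroup (Fin 2) (ZMod 5) →* Perm (Fin 5) :=
    ((WreathSemi.proj (Perm (Fin 5)) X ℤˣ).comp ι).comp (QuotientGroup.mk' pmOne)
  have hcard : Nat.card (Matrix.GeneralLinearGroup (Fin 2) (ZMod 5)) = 480 := by
    have : Fact (Nat.Prime 5) := ⟨Nat.prime_five⟩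
    rw [Matrix.card_GL_field, Fin.prod_univ_two]
    simp [ZMod.card]
  have hker : Nat.card φ.ker ≤ 4 := by
    have h0 : ∀ g : φ.ker, ∃ c : {c : ZMod 5 // c ≠ 0},
        ((g : Matrix.GeneralLinearGroup (Fin 2) (ZMod 5)) : Matrix (Fin 2) (Fin 2) (ZMod 5)) =
          (c : ZMod 5) • (1 : Matrix _ _ _) := by
      rintro ⟨g, hg⟩
      obtain ⟨a, c, hc, hg, -⟩ := (hι g).eq_smul_one_of_right_eq_one hv hg
      refine ⟨⟨c, ?_⟩, hg⟩
      rintro rfl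
      clear * - hc
      revert a; decide
    choose c hc using h0
    have hinj : Function.Injective c := fun g g' h =>
      Subtype.ext (Units.ext (by rw [hc, hc, h]))
    refine (Nat.card_le_card_of_injective c hinj).trans ?_
    rw [Nat.card_eq_fintype_card]
    decide
  have hr : φ.range = ⊤ := by
    apply Subgroup.eq_top_of_le_card
    have h1 := φ.ker.card_mul_index
    rw [Subgroup.index_ker, hcard] at h1
    have h2 : Nat.card (Perm (Fin 5)) = 120 := by
      rw [Nat.card_eq_fintype_card, Fintype.card_perm, Fintype.card_fin]; rfl
    rw [h2]
    nlinarith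
  obtain ⟨g, hg⟩ := MonoidHom.range_eq_top.mp hr σ
  exact ⟨g, hg⟩

include hv hι in
theorem range_mem_extensions_of_pairAction [MulAction.IsPretransitive (Perm (Fin 5)) X]
    (hX : Nat.card X = 6) :
    ι.range ∈ WreathSemi.extensions (Perm (Fin 5)) X ℤˣ := by
  refine ⟨top_le_iff.mp fun σ _ => ?_, le_antisymm ?_ ?_⟩
  · obtain ⟨g, hg⟩ := exists_right_eq_of_pairAction hv hι σ
    exact ⟨_, ⟨_, rfl⟩, hg⟩
  · rintro _ ⟨h1, q, rfl⟩
    obtain ⟨g, rfl⟩ := QuotientGroup.mk_surjective q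
    obtain ⟨a, -, -, -, h⟩ := (hι g).eq_smul_one_of_right_eq_one hv h1
    exact ⟨a, h.symm⟩
  · rintro _ ⟨a, rfl⟩
    obtain ⟨g, -, -, -, h⟩ := diag_mem_range_of_pairAction hv hι hX a
    exact ⟨MonoidHom.mem_ker.mpr rfl, _, h⟩

include hv hι in
-- A section would give every permutation a lift with `det ^ 2 = 1`, by induction on products of
-- transpositions. A matrix inducing the same permutation as `diag(2, 1)` is a scalar multiple of
-- it, so has `det ^ 2 = -1`.
theorem not_splitsOver_top_of_pairAction : ¬ WreathSemi.SplitsOver ι.range ⊤ := by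
  rintro ⟨s, hs⟩
  have key : ∀ (σ : Perm (Fin 5)), ∃ g : Matrix.GeneralLinearGroup (Fin 2) (ZMod 5),
      ι (QuotientGroup.mk g) = s ⟨σ, Subgroup.mem_top σ⟩ ∧
        (g : Matrix (Fin 2) (Fin 2) (ZMod 5)).det ^ 2 = 1 := by
    intro σ
    induction σ using Perm.swap_induction_on with
    | one =>
      refine ⟨1, ?_, by simp⟩
      have : (⟨1, Subgroup.mem_top 1⟩ : (⊤ : Subgroup (Perm (Fin 5)))) = 1 := rfl
      rw [this, map_one]
      exact map_one ι
    | swap_mul σ i j hij ih =>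
      obtain ⟨g, hg, hg'⟩ := ih
      obtain ⟨q, hq⟩ := (s ⟨swap i j, Subgroup.mem_top _⟩).2
      obtain ⟨r, rfl⟩ := QuotientGroup.mk_surjective q
      refine ⟨r * g, ?_, ?_⟩
      · have : (⟨swap i j * σ, Subgroup.mem_top _⟩ : (⊤ : Subgroup (Perm (Fin 5)))) =
          ⟨swap i j, Subgroup.mem_top _⟩ * ⟨σ, Subgroup.mem_top _⟩ := rfl
        rw [this, map_mul, QuotientGroup.mk_mul, map_mul, hg, hq]
        rfl
      · have h1 : ι (QuotientGroup.mk (r * r)) = ι 1 := by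
          rw [QuotientGroup.mk_mul, map_mul, hq, ← Subgroup.coe_mul, ← map_mul, map_one]
          have : (⟨swap i j, Subgroup.mem_top _⟩ : (⊤ : Subgroup (Perm (Fin 5)))) *
            ⟨swap i j, Subgroup.mem_top _⟩ = 1 := Subtype.ext (swap_mul_self i j)
          rw [this, map_one]
          rfl
        have h2 := injective_of_pairAction hv hι h1
        rw [QuotientGroup.eq_one_iff, pmOne] at h2
        have h3 : Subgroup.zpowers (-1 : Matrix.GeneralLinearGroup (Fin 2) (ZMod 5)) ≤
            (Matrix.GeneralLinearGroup.det).ker := by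
          rw [Subgroup.zpowers_le, MonoidHom.mem_ker]
          exact Units.ext (by simp [Matrix.det_neg])
        have h4 := congrArg Units.val (MonoidHom.mem_ker.mp (h3 h2))
        have h5 : (r : Matrix (Fin 2) (Fin 2) (ZMod 5)).det ^ 2 = 1 := by
          rw [sq, ← Matrix.det_mul]
          exact h4
        rw [Units.val_mul, Matrix.det_mul, mul_pow, h5, hg', one_mul]
  let d : Matrix.GeneralLinearGroup (Fin 2) (ZMod 5) :=
    ⟨!![2, 0; 0, 1], !![3, 0; 0, 1], by decide, by decide⟩
  obtain ⟨g, hg, hg'⟩ := key (ι (QuotientGroup.mk d)).right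
  have hr : (ι (QuotientGroup.mk (d * g⁻¹))).right = 1 := by
    have h1 : (ι (QuotientGroup.mk g)).right = (ι (QuotientGroup.mk d)).right := by
      rw [hg]; exact hs _
    rw [QuotientGroup.mk_mul, QuotientGroup.mk_inv, map_mul, map_inv,
      SemidirectProduct.mul_right, SemidirectProduct.inv_right, h1, mul_inv_cancel]
  obtain ⟨a, c, hc, h, -⟩ := (hι (d * g⁻¹)).eq_smul_one_of_right_eq_one hv hr
  have h1 : (d : Matrix (Fin 2) (Fin 2) (ZMod 5)) = c • (g : Matrix (Fin 2) (Fin 2) (ZMod 5)) := by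
    have : (d : Matrix (Fin 2) (Fin 2) (ZMod 5)) =
        ((d * g⁻¹ : Matrix.GeneralLinearGroup (Fin 2) (ZMod 5)) :
          Matrix (Fin 2) (Fin 2) (ZMod 5)) * g := by
      rw [← Units.val_mul, inv_mul_cancel_right]
    rw [this, h, smul_mul_assoc, one_mul]
  have h2 := congrArg (fun M : Matrix (Fin 2) (Fin 2) (ZMod 5) => M.det ^ 2) h1
  simp only [Matrix.det_smul, Fintype.card_fin, mul_pow, hg', hc] at h2
  have h3 : (d : Matrix (Fin 2) (Fin 2) (ZMod 5)).det ^ 2 = -1 := by decide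
  rw [h3] at h2
  clear * - h2
  revert a; decide

include hv hι in
-- Two lifts of determinant `1` of the same permutation differ by a scalar `c` with `c ^ 2 = 1`,
-- hence have the same image under `ι`; this makes their choice multiplicative.
theorem splitsOver_alternatingGroup_of_pairAction [MulAction.IsPretransitive (Perm (Fin 5)) X]
    (hX : Nat.card X = 6)
    (hsign : ∀ g : Matrix.GeneralLinearGroup (Fin 2) (ZMod 5),
      (g : Matrix (Fin 2) (Fin 2) (ZMod 5)).det ^ 2 =
        ((Perm.sign (ι (QuotientGroup.mk g)).right : ℤ) : ZMod 5)) :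
    WreathSemi.SplitsOver ι.range (alternatingGroup (Fin 5)) := by
  have hex : ∀ σ : alternatingGroup (Fin 5), ∃ g : Matrix.GeneralLinearGroup (Fin 2) (ZMod 5),
      (g : Matrix (Fin 2) (Fin 2) (ZMod 5)).det = 1 ∧ (ι (QuotientGroup.mk g)).right = σ := by
    rintro ⟨σ, hσ⟩
    obtain ⟨g, rfl⟩ := exists_right_eq_of_pairAction hv hι σ
    have h1 := hsign g
    rw [Equiv.Perm.mem_alternatingGroup.mp hσ] at h1
    have h2 : ∀ c : ZMod 5, c ^ 2 = ((1 : ℤˣ) : ℤ) → c = 1 ∨ c = -1 := by decide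
    rcases h2 _ h1 with h | h
    · exact ⟨g, h, rfl⟩
    -- A scalar with square `-1` has determinant `-1` and trivial permutation, so it corrects the
    -- determinant.
    · obtain ⟨r, c, hr, hc, hd⟩ := diag_mem_range_of_pairAction hv hι hX (-1)
      refine ⟨r * g, ?_, ?_⟩
      · rw [Units.val_mul, Matrix.det_mul, h, hr, Matrix.det_smul, Fintype.card_fin, hc]
        simp
      · rw [QuotientGroup.mk_mul, map_mul, hd, SemidirectProduct.mul_right,
          WreathSemi.diag_right, one_mul]
  have huniq : ∀ g g' : Matrix.GeneralLinearGroup (Fin 2) (ZMod 5),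
      (g : Matrix (Fin 2) (Fin 2) (ZMod 5)).det = 1 →
      (g' : Matrix (Fin 2) (Fin 2) (ZMod 5)).det = 1 →
      (ι (QuotientGroup.mk g)).right = (ι (QuotientGroup.mk g')).right →
      ι (QuotientGroup.mk g) = ι (QuotientGroup.mk g') := by
    intro g g' hg hg' h
    have hr : (ι (QuotientGroup.mk (g * g'⁻¹))).right = 1 := by
      rw [QuotientGroup.mk_mul, QuotientGroup.mk_inv, map_mul, map_inv,
        SemidirectProduct.mul_right, SemidirectProduct.inv_right, h, mul_inv_cancel]
    obtain ⟨a, c, hc, h1, h2⟩ := (hι (g * g'⁻¹)).eq_smul_one_of_right_eq_one hv hr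
    have h3 : (g : Matrix (Fin 2) (Fin 2) (ZMod 5)) =
        c • (g' : Matrix (Fin 2) (Fin 2) (ZMod 5)) := by
      have : (g : Matrix (Fin 2) (Fin 2) (ZMod 5)) =
          ((g * g'⁻¹ : Matrix.GeneralLinearGroup (Fin 2) (ZMod 5)) :
          Matrix (Fin 2) (Fin 2) (ZMod 5)) * g' := by
        rw [← Units.val_mul, inv_mul_cancel_right]
      rw [this, h1, smul_mul_assoc, one_mul]
    have h4 : ((a : ℤ) : ZMod 5) = 1 := by
      have := congrArg Matrix.det h3
      rw [Matrix.det_smul, hg, hg', Fintype.card_fin, hc, mul_one] at this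
      exact this.symm
    have h5 : a = 1 := by clear * - h4; revert a; decide
    rw [h5, map_one, QuotientGroup.mk_mul, QuotientGroup.mk_inv, map_mul, map_inv,
      mul_inv_eq_one] at h2
    exact h2
  choose g hg hg' using hex
  refine ⟨MonoidHom.mk' (fun σ => ⟨ι (QuotientGroup.mk (g σ)), _, rfl⟩) fun σ τ =>
    Subtype.ext ?_, fun σ => hg' σ⟩
  have : ι (QuotientGroup.mk (g (σ * τ))) = ι (QuotientGroup.mk (g σ * g τ)) := by
    refine huniq _ _ (hg _) (by rw [Units.val_mul, Matrix.det_mul, hg, hg, one_mul]) ?_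
    rw [hg', QuotientGroup.mk_mul, map_mul, SemidirectProduct.mul_right, hg', hg']
    rfl
  exact this.trans (by rw [QuotientGroup.mk_mul, map_mul]; rfl)

end

end NaturalHom

theorem mainTheorem7 (X : Type*) [MulAction (Perm (Fin 5)) X]
    [MulAction.IsPretransitive (Perm (Fin 5)) X] (hX : Nat.card X = 6) :
    ∃ K₀ : Subgroup (WreathSemi (Perm (Fin 5)) X ℤˣ),
      WreathSemi.extensions (Perm (Fin 5)) X ℤˣ =
          subgroupConjClass (WreathSemi.splitExt (Perm (Fin 5)) X ℤˣ) ∪ subgroupConjClass K₀ ∧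
      Disjoint (subgroupConjClass (WreathSemi.splitExt (Perm (Fin 5)) X ℤˣ))
          (subgroupConjClass K₀) ∧
      (∀ K ∈ subgroupConjClass (WreathSemi.splitExt (Perm (Fin 5)) X ℤˣ),
          WreathSemi.SplitsOver K ⊤) ∧
      (∀ K ∈ subgroupConjClass K₀,
          ¬ WreathSemi.SplitsOver K ⊤ ∧ WreathSemi.SplitsOver K (alternatingGroup (Fin 5))) ∧
      (∃ ι : GLModPm →* WreathSemi (Perm (Fin 5)) X ℤˣ, IsNaturalHom ι) ∧
      (∀ ι : GLModPm →* WreathSemi (Perm (Fin 5)) X ℤˣ, IsNaturalHom ι →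
          Function.Injective ι ∧ ι.range ∈ subgroupConjClass K₀) := by
  obtain ⟨v, ι, hv, h⟩ := exists_hom_pairAction_sign hX
  have hι := fun g => (h g).1
  have hsplit : ∀ K ∈ subgroupConjClass (WreathSemi.splitExt (Perm (Fin 5)) X ℤˣ),
      WreathSemi.SplitsOver K ⊤ := by
    rintro _ ⟨a, rfl⟩
    exact WreathSemi.splitExt_splitsOver_top.conj a
  have hK₀ := range_mem_extensions_of_pairAction hv hι hX
  have hns := not_splitsOver_top_of_pairAction hv hι
  have hns' : ∀ K ∈ subgroupConjClass ι.range, ¬ WreathSemi.SplitsOver K ⊤ := by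
    intro K hK hs
    obtain ⟨a, ha⟩ := mem_subgroupConjClass_symm hK
    exact hns (ha ▸ hs.conj a)
  refine ⟨ι.range, Set.Subset.antisymm ?_ ?_, ?_, hsplit, fun K hK => ⟨hns' K hK, ?_⟩,
    ⟨ι, isNaturalHom_iff.mpr ⟨v, hv, hι⟩⟩, fun ι' hι' => ?_⟩
  · intro K hK
    by_cases hs : K ∈ subgroupConjClass (WreathSemi.splitExt (Perm (Fin 5)) X ℤˣ)
    · exact Or.inl hs
    · exact Or.inr (mem_subgroupConjClass_of_not_split hX hK₀ hK (fun h => hns (hsplit _ h)) hs)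
  · rintro _ (⟨a, rfl⟩ | ⟨a, rfl⟩)
    · exact WreathSemi.conj_mem_extensions a WreathSemi.splitExt_mem_extensions
    · exact WreathSemi.conj_mem_extensions a hK₀
  · exact Set.disjoint_left.mpr fun K hK hK' => hns' K hK' (hsplit K hK)
  · obtain ⟨a, rfl⟩ := hK
    exact (splitsOver_alternatingGroup_of_pairAction hv hι hX fun g => (h g).2).conj a
  · obtain ⟨v', hv', hι'⟩ := isNaturalHom_iff.mp hι'
    -- Any other natural homomorphism also has a nonsplit image, so the classification makes that
    -- image conjugate to the chosen one.
    exact ⟨injective_of_pairAction hv' hι', mem_subgroupConjClass_of_not_split hX hK₀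
      (range_mem_extensions_of_pairAction hv' hι' hX) (fun h => hns (hsplit _ h))
      fun h => not_splitsOver_top_of_pairAction hv' hι' (hsplit _ h)⟩
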